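/- Setting. Let $N\ge 1$, $\Sigma=\{1,\dots,N\}^{\mathbb N}$ with left shift $\sigma$, let $[w]\subset\Sigma$ be the cylinder of a finite word $w$, and let $\mathcal M_\sigma(\Sigma)$ be the set of $\sigma$-invariant Borel probability measures on $\Sigma$. For a function $\theta>0$ on finite words and $\nu\in\mathcal M_\sigma(\Sigma)$ put (when the limits exist, as they do below) $$\Lambda(\theta,\nu)=\lim_{n\to\infty}\tfrac1n\int_\Sigma\log\theta(\mathtt i|_n)\,d\nu(\mathtt i),\qquad P(\theta)=\lim_{n\to\infty}\tfrac1n\log\sum_{|w|=n}\theta(w),\qquad h(\nu)=-\lim_{n\to\infty}\tfrac1n\sum_{|w|=n}\nu([w])\log\nu([w]).$$ An equilibrium state for $\theta$ is a $\nu\in\mathcal M_\sigma(\Sigma)$ with $P(\theta)=h(\nu)+\Lambda(\theta,\nu)$. A Borel probability measure $\mu$ on $\Sigma$ is fully supported if $\mu([w])>0$ for every finite word $w$, and quasi-Bernoulli if there is $C\ge1$ with $C^{-1}\mu([u])\mu([v])\le\mu([uv])\le C\mu([u])\mu([v])$ for all finite words $u,v$; for such $\mu$ put $h(\mu,\nu)=-\Lambda(\mu([\,\cdot\,]),\nu)$.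 Let $\mathsf A=(A_1,\dots,A_N)\in GL_2(\mathbb R)^N$ be contractive, i.e. $\|A_i\|<1$ in the Euclidean operator norm for all $i$, write $A_w=A_{i_1}\cdots A_{i_n}$ for $w=i_1\cdots i_n$, and let $\alpha_1(w)=\|A_w\|\ge\alpha_2(w)=\|A_w^{-1}\|^{-1}$ be the singular values of $A_w$. The tuple $\mathsf A$ is dominated if there are $C>0$, $0<t<1$ with $\alpha_2(w)\le Ct^{|w|}\alpha_1(w)$ for all finite words $w$. Let $\varphi^s(w)=\alpha_1(w)^s$ for $0\le s<1$, $\varphi^s(w)=\alpha_1(w)\alpha_2(w)^{s-1}$ for $1\le s<2$, and $\varphi^s(w)=|\det A_w|^{s/2}$ for $s\ge2$. The Lyapunov dimension $\dim_L(\nu)$ and the Lyapunov cross-dimension $\dim_L(\mu,\nu)$ are the unique $s\ge0$ with $h(\nu)+\Lambda(\varphi^s,\nu)=0$ and with $h(\mu,\nu)+\Lambda(\varphi^s,\nu)=0$, respectively. For $q\in\mathbb R$ and $s\ge0$ let $\psi^{q,s}(w)=\mu([w])^q\varphi^s(w)^{1-q}$. For $q\ne1$ let $s_q$ be the unique $s\ge0$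 with $P(\psi^{q,s})=0$, and put $\tau(q)=(q-1)s_q$, $\tau(1)=0$. Finally let $$f(s)=\sup\{\dim_L(\eta):\eta\in\mathcal M_\sigma(\Sigma),\ \dim_L(\mu,\eta)=s\}.$$ Theorem. Let $\mathsf A$ be a dominated tuple of contractive matrices, $\mu$ a fully supported quasi-Bernoulli measure, $q\neq1$, and let $I$ be one of the intervals $(0,1)$, $(1,2)$, $(2,\infty)$. Suppose that $\tau(q)/(q-1)\in I$. Then $\tau$ is differentiable at $q$ and there is a unique equilibrium state $\nu$ for $\psi^{q,\tau(q)/(q-1)}$. If moreover $\tau'(q)\in I$ and $q\tau'(q)-\tau(q)\in I$, then $$\tau'(q)\le\frac{\tau(q)}{q-1}\ \text{ if } q>1,\qquad \tau'(q)\ge\frac{\tau(q)}{q-1}\ \text{ if } q<1,$$ and $$f(\tau'(q))=\dim_L(\nu)=q\tau'(q)-\tau(q),$$ i.e. $\tau$ and $f$ form a Legendre transform pair at $(q,\tau'(q))$. -/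

import Mathlib

open MeasureTheory Filter Topology

noncomputable section

namespace SelfAffine

/-! ### The shift space over the alphabet `Fin N`

Infinite words are functions `ℕ → Fin N`, with the product (which is the Borel) sigma-algebra;
finite words are lists. -/

/-- The left shift. -/
def shift {N : ℕ} (x : ℕ → Fin N) : ℕ → Fin N := fun k => x (k + 1)

/-- The prefix of length `n` of an infinite word. -/
def pre {N : ℕ} (x : ℕ → Fin N) (n : ℕ) : List (Fin N) := List.ofFn fun k : Fin n => x k

/-- The cylinder set of a finite word: all infinite words that begin with it. -/
def cyl {N : ℕ} (w : List (Fin N)) : Set (ℕ → Fin N) := {x | pre x w.length = w}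

/-- The shift-invariant Borel probability measures. -/
def IsInvariant {N : ℕ} (ν : Measure (ℕ → Fin N)) : Prop :=
  IsProbabilityMeasure ν ∧ MeasurePreserving shift ν ν

/-- Every cylinder set has positive measure. -/
def IsFullySupported {N : ℕ} (μ : Measure (ℕ → Fin N)) : Prop :=
  ∀ w : List (Fin N), 0 < μ (cyl w)

/-! ### Potentials: functions on finite words -/

/-- `θ(uv) ≤ θ(u) θ(v)` for all finite words. -/
def IsSubmultiplicative {N : ℕ} (θ : List (Fin N) → ℝ) : Prop :=
  ∀ u v : List (Fin N), θ (u ++ v) ≤ θ u * θ v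

/-- `θ(uv) ≥ θ(u) θ(v)` for all finite words. -/
def IsSupermultiplicative {N : ℕ} (θ : List (Fin N) → ℝ) : Prop :=
  ∀ u v : List (Fin N), θ u * θ v ≤ θ (u ++ v)

/-- For some `C ≥ 1`, `C θ` is sub-multiplicative and `C⁻¹ θ` is super-multiplicative. -/
def IsAlmostMultiplicative {N : ℕ} (θ : List (Fin N) → ℝ) : Prop :=
  ∃ C : ℝ, 1 ≤ C ∧ IsSubmultiplicative (fun w => C * θ w) ∧
    IsSupermultiplicative (fun w => C⁻¹ * θ w)

/-- The potential `w ↦ μ([w])` of a measure. -/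
def measurePotential {N : ℕ} (μ : Measure (ℕ → Fin N)) (w : List (Fin N)) : ℝ :=
  μ.real (cyl w)

/-- A measure is quasi-Bernoulli if `w ↦ μ([w])` is almost-multiplicative. -/
def IsQuasiBernoulli {N : ℕ} (μ : Measure (ℕ → Fin N)) : Prop :=
  IsAlmostMultiplicative (measurePotential μ)

/-- `Λ(θ, ν) = lim (1/n) ∫ log θ(x|ₙ) dν(x)`. -/
def lyapunov {N : ℕ} (θ : List (Fin N) → ℝ) (ν : Measure (ℕ → Fin N)) : ℝ :=
  limUnder atTop fun n : ℕ => (1 / (n : ℝ)) * ∫ x, Real.log (θ (pre x n)) ∂ν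

/-- The entropy `h(ν) = - lim (1/n) ∑ ν([w]) log ν([w])`, the sum over words `w` of length `n`. -/
def entropy {N : ℕ} (ν : Measure (ℕ → Fin N)) : ℝ :=
  -limUnder atTop fun n : ℕ => (1 / (n : ℝ)) *
    ∑ w : Fin n → Fin N, ν.real (cyl (List.ofFn w)) * Real.log (ν.real (cyl (List.ofFn w)))

/-- The cross-entropy `h(μ, ν) = - Λ(μ, ν)` of `μ` relative to `ν`. -/
def crossEntropy {N : ℕ} (μ ν : Measure (ℕ → Fin N)) : ℝ :=
  -lyapunov (measurePotential μ) ν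

/-- The pressure `P(θ) = lim (1/n) log ∑ θ(w)`, the sum over words `w` of length `n`. -/
def pressure {N : ℕ} (θ : List (Fin N) → ℝ) : ℝ :=
  limUnder atTop fun n : ℕ =>
    (1 / (n : ℝ)) * Real.log (∑ w : Fin n → Fin N, θ (List.ofFn w))

/-- An equilibrium state for `θ`: an invariant measure with `P(θ) = h(ν) + Λ(θ, ν)`. -/
def IsEquilibriumState {N : ℕ} (θ : List (Fin N) → ℝ) (ν : Measure (ℕ → Fin N)) : Prop :=
  IsInvariant ν ∧ pressure θ = entropy ν + lyapunov θ ν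

/-! ### Matrix tuples -/

/-- The Euclidean operator norm of a real `2 × 2` matrix. -/
def opNorm (M : Matrix (Fin 2) (Fin 2) ℝ) : ℝ :=
  ‖(Matrix.toEuclideanCLM (𝕜 := ℝ) (n := Fin 2) M : EuclideanSpace ℝ (Fin 2) →L[ℝ] _)‖

/-- The product `A_{i₁} ⋯ A_{iₙ}` along a finite word. -/
def wordProd {N : ℕ} (A : Fin N → GL (Fin 2) ℝ) (w : List (Fin N)) : GL (Fin 2) ℝ :=
  (w.map A).prod

/-- The larger singular value of `A_w`. -/
def alpha1 {N : ℕ} (A : Fin N → GL (Fin 2) ℝ) (w : List (Fin N)) : ℝ :=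
  opNorm (wordProd A w).val

/-- The smaller singular value of `A_w`. -/
def alpha2 {N : ℕ} (A : Fin N → GL (Fin 2) ℝ) (w : List (Fin N)) : ℝ :=
  (opNorm ((wordProd A w)⁻¹).val)⁻¹

/-- All matrices have Euclidean operator norm less than one. -/
def IsContractive {N : ℕ} (A : Fin N → GL (Fin 2) ℝ) : Prop :=
  ∀ i, opNorm (A i).val < 1

/-- There are `C > 0` and `0 < t < 1` with `α₂(w) ≤ C tⁿ α₁(w)` for all words `w` of length `n`. -/
def IsDominated {N : ℕ} (A : Fin N → GL (Fin 2) ℝ) : Prop :=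
  ∃ C t : ℝ, 0 < C ∧ 0 < t ∧ t < 1 ∧
    ∀ w : List (Fin N), alpha2 A w ≤ C * t ^ w.length * alpha1 A w

/-- The singular value function `φ^s(w)` (used for `s ≥ 0`). -/
def svf {N : ℕ} (A : Fin N → GL (Fin 2) ℝ) (s : ℝ) (w : List (Fin N)) : ℝ :=
  if s < 1 then alpha1 A w ^ s
  else if s < 2 then alpha1 A w * alpha2 A w ^ (s - 1)
  else |(wordProd A w).val.det| ^ (s / 2)

/-- The `s ≥ 0` with `h + Λ(φ^s, ν) = 0`. For a contractive tuple, an invariant `ν` and `h ≥ 0`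
there is exactly one, since `s ↦ Λ(φ^s, ν)` is continuous and strictly decreasing from `0`
to `-∞`. -/
def dimRoot {N : ℕ} (A : Fin N → GL (Fin 2) ℝ) (h : ℝ) (ν : Measure (ℕ → Fin N)) : ℝ :=
  sInf {s : ℝ | 0 ≤ s ∧ h + lyapunov (svf A s) ν = 0}

/-- The Lyapunov dimension of `ν`: the `s ≥ 0` with `h(ν) + Λ(φ^s, ν) = 0`. -/
def dimL {N : ℕ} (A : Fin N → GL (Fin 2) ℝ) (ν : Measure (ℕ → Fin N)) : ℝ :=
  dimRoot A (entropy ν) ν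

/-- The Lyapunov cross-dimension of `μ` relative to `ν`: the `s ≥ 0` with
`h(μ, ν) + Λ(φ^s, ν) = 0`. -/
def crossDimL {N : ℕ} (A : Fin N → GL (Fin 2) ℝ) (μ ν : Measure (ℕ → Fin N)) : ℝ :=
  dimRoot A (crossEntropy μ ν) ν

/-! ### The symbolic spectra -/

/-- `ψ^{q,s}(w) = μ([w])^q φ^s(w)^{1-q}`. -/
def psi {N : ℕ} (A : Fin N → GL (Fin 2) ℝ) (μ : Measure (ℕ → Fin N)) (q s : ℝ)
    (w : List (Fin N)) : ℝ :=
  measurePotential μ w ^ q * svf A s w ^ (1 - q)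

/-- For `q ≠ 1`, the unique `s ≥ 0` with `P(ψ^{q,s}) = 0`. -/
def sq {N : ℕ} (A : Fin N → GL (Fin 2) ℝ) (μ : Measure (ℕ → Fin N)) (q : ℝ) : ℝ :=
  sInf {s : ℝ | 0 ≤ s ∧ pressure (psi A μ q s) = 0}

/-- The `L^q`-spectrum `τ(q) = (q - 1) s_q`; in particular `τ(1) = 0`. -/
def tau {N : ℕ} (A : Fin N → GL (Fin 2) ℝ) (μ : Measure (ℕ → Fin N)) (q : ℝ) : ℝ :=
  (q - 1) * sq A μ q

/-- The symbolic multifractal spectrum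
`f(s) = sup {dim_L(η) : η invariant with dim_L(μ, η) = s}`. -/
def symbolicSpectrum {N : ℕ} (A : Fin N → GL (Fin 2) ℝ) (μ : Measure (ℕ → Fin N)) (s : ℝ) : ℝ :=
  sSup {d : ℝ | ∃ η : Measure (ℕ → Fin N), IsInvariant η ∧ crossDimL A μ η = s ∧ d = dimL A η}

end SelfAffine

end

/-!
Everything is expressed through functions `f = log θ` on words that are additive up to a bounded
error (`AlmostAdditive`). The argument has three parts.

*Singular values.* Domination makes `log α₁` almost additive; as the determinant is multiplicative,
so are `log α₂` and `log φ^s`. The norm of a matrix, scaled to determinant `±1`, measures how far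
the matrix moves a base point of the hyperbolic plane, and domination says that the orbit along any
word is a quasi-geodesic. Ptolemy's inequality `‖AB‖ ‖BC‖ ≤ ‖ABC‖ ‖B‖ + |det B| ‖A‖ ‖C‖`
(`opNorm_ptolemy`) plays the role of hyperbolicity, and stability of quasi-geodesics becomes almost
multiplicativity of the norm (`IsPtolemaic.exists_mul_le`).

*Thermodynamics.* For almost-additive `f` the variational inequality `h(ν) + Λ(f, ν) ≤ P(f)` is
Gibbs' inequality. An invariant Gibbs measure exists by compactness, is ergodic, and is an
equilibrium state. For any other equilibrium state the relative entropies with respect to it on the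
cylinder partitions are bounded; this forces absolute continuity, and ergodicity then gives
uniqueness (`AlmostAdditive.existsUnique_equilibrium`).

*Legendre pair.* On the interval `I` one has `log φ^s = a + s b`, hence
`log ψ^{q,s} = a + q (log μ - a) + T b` with `T = (1 - q) s`, and along `s = s_q` this gives
`T = -τ(q)`. The equation `P = 0` thus describes a curve in a linear family of potentials. The
variational inequality gives the curve a subgradient at each point, continuous by uniqueness and
compactness of equilibrium states, so `τ` is differentiable
(`hasDerivAt_of_logPressure_eq_zero`), with `τ'(q) Λ(b, ν) = Λ(log μ - a, ν)`. This formula is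
`h(μ, ν) + Λ(φ^{τ'}, ν) = 0`, and together with `P = 0` it yields `h(ν) + Λ(φ^{qτ' - τ}, ν) = 0`.
The variational inequality for an invariant `η` with `dim_L(μ, η) = τ'` reads
`h(η) + Λ(φ^{qτ' - τ}, η) ≤ 0`, which bounds `dim_L(η)`. Finally `h(ν) ≤ h(μ, ν)` gives
`qτ' - τ ≤ τ'`, the stated inequalities.
-/

namespace SelfAffine

variable {N : ℕ}

/-! ### Cylinders and finite words -/

/-- The restriction of an infinite word to its first `n` letters, as a function on `Fin n`. -/
def res (n : ℕ) (x : ℕ → Fin N) : Fin n → Fin N := fun k => x k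

lemma pre_eq_ofFn_res (x : ℕ → Fin N) (n : ℕ) : pre x n = List.ofFn (res n x) := rfl

lemma measurable_res (n : ℕ) : Measurable (res n : (ℕ → Fin N) → _) :=
  measurable_pi_lambda _ fun k => measurable_pi_apply (k : ℕ)

lemma continuous_res (n : ℕ) : Continuous (res n : (ℕ → Fin N) → _) :=
  continuous_pi fun k => continuous_apply (k : ℕ)

lemma measurable_shift : Measurable (shift : (ℕ → Fin N) → _) :=
  measurable_pi_lambda _ fun k => measurable_pi_apply (k + 1)

lemma shift_iterate_apply (m : ℕ) (x : ℕ → Fin N) (k : ℕ) : shift^[m] x k = x (k + m) := by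
  induction m generalizing x with
  | zero => rfl
  | succ m ih =>
    rw [Function.iterate_succ_apply, ih]
    simp only [shift]
    congr 1

lemma cyl_ofFn {n : ℕ} (w : Fin n → Fin N) : cyl (List.ofFn w) = res n ⁻¹' {w} := by
  ext x
  simp only [cyl, Set.mem_ofPred_eq, Set.mem_preimage, Set.mem_singleton_iff, List.length_ofFn,
    pre_eq_ofFn_res]
  exact List.ofFn_injective.eq_iff

lemma cyl_eq_preimage (w : List (Fin N)) : cyl w = res w.length ⁻¹' {w.get} := by
  rw [← cyl_ofFn, List.ofFn_get]

lemma measurableSet_cyl (w : List (Fin N)) : MeasurableSet (cyl w) := by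
  rw [cyl_eq_preimage]
  exact measurable_res _ (measurableSet_singleton _)

lemma isClopen_cyl (w : List (Fin N)) : IsClopen (cyl w) := by
  rw [cyl_eq_preimage]
  exact (isClopen_discrete _).preimage (continuous_res _)

lemma pre_add (x : ℕ → Fin N) (m n : ℕ) : pre x (m + n) = pre x m ++ pre (shift^[m] x) n := by
  have : res (m + n) x = Fin.append (res m x) (res n (shift^[m] x)) := by
    funext k
    refine Fin.addCases (fun i => ?_) (fun i => ?_) k
    · simp [res]
    · simp [res, shift_iterate_apply, add_comm]
  rw [pre_eq_ofFn_res, this, List.ofFn_fin_append]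
  rfl

lemma mem_cyl_append (x : ℕ → Fin N) (u v : List (Fin N)) :
    x ∈ cyl (u ++ v) ↔ x ∈ cyl u ∧ shift^[u.length] x ∈ cyl v := by
  simp only [cyl, Set.mem_ofPred_eq, List.length_append, pre_add]
  constructor
  · intro h
    exact List.append_inj h (by simp [pre])
  · rintro ⟨h1, h2⟩
    rw [h1, h2]

lemma cyl_append (u v : List (Fin N)) :
    cyl (u ++ v) = cyl u ∩ shift^[u.length] ⁻¹' cyl v := by
  ext x
  exact mem_cyl_append x u v

/-- Splitting a sum over words of length `m + n`. -/
lemma sum_words_add (m n : ℕ) (F : List (Fin N) → ℝ) :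
    ∑ w : Fin (m + n) → Fin N, F (List.ofFn w) =
      ∑ u : Fin m → Fin N, ∑ v : Fin n → Fin N, F (List.ofFn u ++ List.ofFn v) := by
  rw [← (Fin.appendEquiv m n).sum_comp, Fintype.sum_prod_type]
  simp_rw [Fin.appendEquiv, Equiv.coe_fn_mk, List.ofFn_fin_append]

lemma sum_real_inter_cyl (ν : Measure (ℕ → Fin N)) [IsFiniteMeasure ν] {E : Set (ℕ → Fin N)}
    (n : ℕ) : ∑ w : Fin n → Fin N, ν.real (cyl (List.ofFn w) ∩ E) = ν.real E := by
  have h := sum_measureReal_preimage_singleton (μ := ν.restrict E)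
    (Finset.univ : Finset (Fin n → Fin N)) (f := res n)
    (fun y _ => measurable_res n (measurableSet_singleton y))
  simp only [Finset.coe_univ, Set.preimage_univ, measureReal_restrict_apply_univ] at h
  rw [← h]
  refine Finset.sum_congr rfl fun w _ => ?_
  rw [measureReal_restrict_apply (measurable_res n (measurableSet_singleton w)), cyl_ofFn]

lemma real_preimage_res (ν : Measure (ℕ → Fin N)) [IsFiniteMeasure ν] (n : ℕ)
    (S : Finset (Fin n → Fin N)) :
    ν.real (res n ⁻¹' S) = ∑ w ∈ S, ν.real (cyl (List.ofFn w)) := by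
  simp_rw [cyl_ofFn]
  exact (sum_measureReal_preimage_singleton S
    (fun y _ => measurable_res n (measurableSet_singleton y))).symm

lemma sum_real_cyl (ν : Measure (ℕ → Fin N)) [IsProbabilityMeasure ν] (n : ℕ) :
    ∑ w : Fin n → Fin N, ν.real (cyl (List.ofFn w)) = 1 := by
  have := sum_real_inter_cyl ν (E := Set.univ) n
  simpa using this

/-- Summing over the first letters yields the measure of a shifted cylinder. -/
lemma sum_real_cyl_append_left (ν : Measure (ℕ → Fin N)) [IsFiniteMeasure ν] (n : ℕ)
    (v : List (Fin N)) : ∑ u : Fin n → Fin N, ν.real (cyl (List.ofFn u ++ v)) =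
      ν.real (shift^[n] ⁻¹' cyl v) := by
  rw [← sum_real_inter_cyl ν n]
  refine Finset.sum_congr rfl fun w _ => ?_
  rw [cyl_append, List.length_ofFn]

lemma sum_real_cyl_append_right (ν : Measure (ℕ → Fin N)) [IsFiniteMeasure ν] (n : ℕ)
    (u : List (Fin N)) : ∑ v : Fin n → Fin N, ν.real (cyl (u ++ List.ofFn v)) =
      ν.real (cyl u) := by
  have h := sum_measureReal_preimage_singleton (μ := ν.restrict (cyl u))
    (Finset.univ : Finset (Fin n → Fin N)) (f := res n ∘ shift^[u.length])
    (fun y _ => ((measurable_res n).comp (measurable_shift.iterate _)) (measurableSet_singleton y))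
  simp only [Finset.coe_univ, Set.preimage_univ, measureReal_restrict_apply_univ] at h
  rw [← h]
  refine Finset.sum_congr rfl fun w _ => ?_
  rw [measureReal_restrict_apply
    (((measurable_res n).comp (measurable_shift.iterate _)) (measurableSet_singleton _)),
    cyl_append, cyl_ofFn, Set.inter_comm, Set.preimage_comp]

lemma integral_pre (ν : Measure (ℕ → Fin N)) [IsFiniteMeasure ν] (n : ℕ)
    (f : List (Fin N) → ℝ) :
    ∫ x, f (pre x n) ∂ν = ∑ w : Fin n → Fin N, ν.real (cyl (List.ofFn w)) * f (List.ofFn w) := by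
  have hm := measurable_res (N := N) n
  have h1 : ∫ x, f (pre x n) ∂ν = ∫ y, f (List.ofFn y) ∂(ν.map (res n)) := by
    rw [integral_map hm.aemeasurable (measurable_of_finite _).aestronglyMeasurable]
    rfl
  rw [h1, integral_fintype (Integrable.of_finite)]
  refine Finset.sum_congr rfl fun w _ => ?_
  rw [map_measureReal_apply hm (measurableSet_singleton _), cyl_ofFn, smul_eq_mul]

lemma IsInvariant.real_preimage {ν : Measure (ℕ → Fin N)} (hν : IsInvariant ν) (n : ℕ)
    {E : Set (ℕ → Fin N)} (hE : MeasurableSet E) : ν.real (shift^[n] ⁻¹' E) = ν.real E := by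
  rw [Measure.real, (hν.2.iterate n).measure_preimage hE.nullMeasurableSet, Measure.real]

/-! ### The cylinder algebra -/

/-- Every measurable cylinder is determined by finitely many initial letters. -/
lemma exists_res_preimage {t : Set (ℕ → Fin N)}
    (ht : t ∈ measurableCylinders fun _ : ℕ => Fin N) :
    ∃ (n : ℕ) (S : Finset (Fin n → Fin N)), t = res n ⁻¹' S := by
  classical
  obtain ⟨s, S, hS, rfl⟩ := (mem_measurableCylinders t).1 ht
  refine ⟨s.sup id + 1, Finset.univ.filter fun w => (fun i : s => w ⟨i, ?_⟩) ∈ S, ?_⟩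
  · exact Nat.lt_succ_of_le (Finset.le_sup (f := id) i.2)
  · ext x
    simp [cylinder, res]
    rfl

/-- A probability measure is determined by its values on cylinders. -/
lemma ext_of_cyl {ν η : Measure (ℕ → Fin N)} [IsProbabilityMeasure ν] [IsProbabilityMeasure η]
    (h : ∀ w, ν.real (cyl w) = η.real (cyl w)) : ν = η := by
  refine ext_of_generate_finite _ (generateFrom_measurableCylinders (α := fun _ : ℕ => Fin N)).symm
    isPiSystem_measurableCylinders (fun t ht => ?_) (by simp)
  obtain ⟨n, S, rfl⟩ := exists_res_preimage ht
  rw [← measureReal_eq_measureReal_iff, real_preimage_res, real_preimage_res]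
  exact Finset.sum_congr rfl fun w _ => h _

/-- A measurable set is approximated by finite unions of cylinders of equal length. -/
lemma exists_res_approx (ν : Measure (ℕ → Fin N)) [IsFiniteMeasure ν] {E : Set (ℕ → Fin N)}
    (hE : MeasurableSet E) {ε : ℝ} (hε : 0 < ε) :
    ∃ (n : ℕ) (S : Finset (Fin n → Fin N)), ν.real (symmDiff (res n ⁻¹' S) E) < ε := by
  obtain ⟨t, ht, h⟩ := exists_measure_symmDiff_lt_of_generateFrom_isSetRing (μ := ν)
    (isSetRing_measurableCylinders (α := fun _ : ℕ => Fin N))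
    ⟨{Set.univ}, Set.countable_singleton _,
      by simpa using univ_mem_measurableCylinders fun _ : ℕ => Fin N, by simp⟩
    generateFrom_measurableCylinders.symm hE (ENNReal.ofReal_pos.2 hε)
  obtain ⟨n, S, rfl⟩ := exists_res_preimage ht
  exact ⟨n, S, (ENNReal.lt_ofReal_iff_toReal_lt (measure_ne_top _ _)).1 h⟩

/-- Cylinder-wise compactness of the probability measures: the shift space is compact and cylinders
are clopen, so weak limits are limits on cylinders. -/
lemma exists_tendsto_cyl {ι : Type*} (U : Ultrafilter ι) (ν : ι → Measure (ℕ → Fin N))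
    (hν : ∀ i, IsProbabilityMeasure (ν i)) :
    ∃ η : Measure (ℕ → Fin N), IsProbabilityMeasure η ∧
      ∀ w, Tendsto (fun i => (ν i).real (cyl w)) U (𝓝 (η.real (cyl w))) := by
  let p : ι → ProbabilityMeasure (ℕ → Fin N) := fun i => ⟨ν i, hν i⟩
  obtain ⟨η, -, hη⟩ := isCompact_univ.ultrafilter_le_nhds (U.map p) (by simp)
  refine ⟨η, inferInstance, fun w => ?_⟩
  have hp : Tendsto p U (𝓝 η) := hη
  exact (NNReal.tendsto_coe.2
    (ProbabilityMeasure.tendsto_measure_of_isClopen_of_tendsto hp (isClopen_cyl w)))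

/-! ### Almost-additive functions on words -/

/-- `f(uv) = f(u) + f(v)` up to an error of at most `C`: the logarithms of almost-multiplicative
potentials. -/
def AlmostAdditive (C : ℝ) (f : List (Fin N) → ℝ) : Prop :=
  ∀ u v : List (Fin N), |f (u ++ v) - (f u + f v)| ≤ C

namespace AlmostAdditive

variable {C D : ℝ} {f g : List (Fin N) → ℝ}

lemma const_nonneg (h : AlmostAdditive C f) : 0 ≤ C := (abs_nonneg _).trans (h [] [])

lemma const_mul (h : AlmostAdditive C f) (a : ℝ) :
    AlmostAdditive (|a| * C) fun w => a * f w := by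
  intro u v
  rw [show a * f (u ++ v) - (a * f u + a * f v) = a * (f (u ++ v) - (f u + f v)) by ring, abs_mul]
  exact mul_le_mul_of_nonneg_left (h u v) (abs_nonneg a)

lemma add (hf : AlmostAdditive C f) (hg : AlmostAdditive D g) :
    AlmostAdditive (C + D) fun w => f w + g w := by
  intro u v
  rw [show f (u ++ v) + g (u ++ v) - (f u + g u + (f v + g v)) =
    (f (u ++ v) - (f u + f v)) + (g (u ++ v) - (g u + g v)) by ring]
  exact (abs_add_le _ _).trans (add_le_add (hf u v) (hg u v))

lemma zero : AlmostAdditive 0 fun _ : List (Fin N) => (0 : ℝ) := by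
  intro u v; simp

lemma add_length (hf : AlmostAdditive C f) (a : ℝ) :
    AlmostAdditive C fun w => f w + w.length * a := by
  intro u v
  convert hf u v using 2
  simp only [List.length_append, Nat.cast_add]
  ring

lemma exists_linear_bound (hf : AlmostAdditive C f) :
    ∃ K : ℝ, 0 ≤ K ∧ ∀ w, |f w| ≤ w.length * K + C := by
  have hC := hf.const_nonneg
  have hs : ∀ i, |f [i]| ≤ ∑ i, |f [i]| := fun i =>
    Finset.single_le_sum (f := fun i => |f [i]|) (fun _ _ => abs_nonneg _) (Finset.mem_univ i)
  refine ⟨(∑ i, |f [i]|) + C, by positivity, fun w => ?_⟩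
  induction w with
  | nil =>
    have := abs_le.1 (hf [] [])
    simp only [List.append_nil] at this
    simp only [List.length_nil, Nat.cast_zero, zero_mul, zero_add]
    rw [abs_le]
    constructor <;> linarith
  | cons i w ih =>
    have h1 := abs_le.1 (hf [i] w)
    have h2 := abs_le.1 ih
    have h3 := abs_le.1 (hs i)
    simp only [List.singleton_append] at h1
    simp only [List.length_cons, Nat.cast_add, Nat.cast_one]
    rw [abs_le]
    constructor <;> linarith

end AlmostAdditive

/-- Bounded errors do not affect growth rates. -/
lemma le_of_forall_nat_mul_le {x y D : ℝ} (h : ∀ n : ℕ, n * x ≤ n * y + D) : x ≤ y := by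
  by_contra! hlt
  obtain ⟨n, hn⟩ := exists_nat_gt (D / (x - y))
  rw [div_lt_iff₀ (sub_pos.2 hlt)] at hn
  linarith [h n]

/-- Fekete's lemma for almost-additive sequences, with the rate of convergence. -/
lemma exists_lim_of_almost_additive {a : ℕ → ℝ} {C : ℝ}
    (h : ∀ m n, |a (m + n) - (a m + a n)| ≤ C) :
    ∃ L, (∀ n : ℕ, |a n - n * L| ≤ C) ∧ Tendsto (fun n : ℕ => 1 / (n : ℝ) * a n) atTop (𝓝 L) := by
  have hC : 0 ≤ C := (abs_nonneg _).trans (h 0 0)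
  have h0 : |a 0| ≤ C := by
    have := abs_le.1 (h 0 0)
    simp only [add_zero] at this
    rw [abs_le]; constructor <;> linarith
  -- The sequence `b + C` is subadditive; this one-sided bound is used for `a` and for `-a`.
  have key : ∀ b : ℕ → ℝ, (∀ m n, |b (m + n) - (b m + b n)| ≤ C) → |b 0| ≤ C →
      ∃ L, (∀ n : ℕ, n * L ≤ b n + C) ∧
        Tendsto (fun n : ℕ => 1 / (n : ℝ) * b n) atTop (𝓝 L) := by
    intro b hb hb0
    have hsub : Subadditive fun n => b n + C := by
      intro m n
      have := (abs_le.1 (hb m n)).2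
      simp only
      linarith
    have hlow : ∀ n : ℕ, n * (b 1 - C) ≤ b n + C := by
      intro n
      induction n with
      | zero => simpa using by linarith [(abs_le.1 hb0).1]
      | succ n ih =>
        have := (abs_le.1 (hb n 1)).1
        push_cast
        linarith
    have hbdd : BddBelow (Set.range fun n : ℕ => (b n + C) / n) := by
      refine ⟨min 0 (b 1 - C), ?_⟩
      rintro _ ⟨n, rfl⟩
      rcases Nat.eq_zero_or_pos n with rfl | hn
      · simp
      · have hn' : (0 : ℝ) < n := by exact_mod_cast hn
        simp only
        rw [le_div_iff₀ hn']
        have := hlow n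
        nlinarith [min_le_right 0 (b 1 - C)]
    refine ⟨hsub.lim, fun n => ?_, ?_⟩
    · rcases Nat.eq_zero_or_pos n with rfl | hn
      · simpa using by linarith [(abs_le.1 hb0).1]
      · have hn' : (0 : ℝ) < n := by exact_mod_cast hn
        have := hsub.lim_le_div hbdd hn.ne'
        rw [le_div_iff₀ hn'] at this
        linarith
    · have h1 := hsub.tendsto_lim hbdd
      have h2 := (tendsto_const_div_atTop_nhds_zero_nat C)
      have := h1.sub h2
      rw [sub_zero] at this
      refine this.congr fun n => ?_
      ring
  obtain ⟨L, hL, hT⟩ := key a h h0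
  obtain ⟨L', hL', hT'⟩ := key (fun n => -a n)
    (fun m n => by rw [← abs_neg]; convert h m n using 2; ring) (by rwa [abs_neg])
  have hLL : L' = -L := by
    refine tendsto_nhds_unique hT' ?_
    simpa using hT.neg
  refine ⟨L, fun n => ?_, hT⟩
  have h1 := hL n
  have h2 := hL' n
  rw [hLL] at h2
  rw [abs_le]
  constructor <;> linarith

/-! ### Lyapunov exponents -/

/-- `lim (1/n) ∫ f(x|ₙ) dν(x)`, so that `Λ(θ, ν)` is the mean growth of `log θ`. -/
noncomputable def meanGrowth (f : List (Fin N) → ℝ) (ν : Measure (ℕ → Fin N)) : ℝ :=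
  limUnder atTop fun n : ℕ => (1 / (n : ℝ)) * ∫ x, f (pre x n) ∂ν

lemma lyapunov_eq_meanGrowth (θ : List (Fin N) → ℝ) (ν : Measure (ℕ → Fin N)) :
    lyapunov θ ν = meanGrowth (fun w => Real.log (θ w)) ν := rfl

lemma integrable_pre (ν : Measure (ℕ → Fin N)) [IsFiniteMeasure ν] (n : ℕ)
    (f : List (Fin N) → ℝ) : Integrable (fun x => f (pre x n)) ν :=
  (Integrable.of_finite (μ := ν.map (res n)) (f := fun y => f (List.ofFn y))).comp_measurable
    (measurable_res n)

lemma IsInvariant.integral_pre_shift {ν : Measure (ℕ → Fin N)} (hν : IsInvariant ν) (m n : ℕ)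
    (f : List (Fin N) → ℝ) :
    ∫ x, f (pre (shift^[m] x) n) ∂ν = ∫ x, f (pre x n) ∂ν := by
  have := hν.1
  have h := hν.2.iterate m
  conv_rhs => rw [← h.map_eq]
  rw [integral_map h.measurable.aemeasurable]
  rw [h.map_eq]
  exact (integrable_pre ν n f).aestronglyMeasurable

namespace AlmostAdditive

variable {C D : ℝ} {f g : List (Fin N) → ℝ} {ν : Measure (ℕ → Fin N)}

/-- The limit defining `meanGrowth` exists, with an error that is uniform in the measure. -/
lemma meanGrowth_spec (hf : AlmostAdditive C f) (hν : IsInvariant ν) :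
    (∀ n : ℕ, |∫ x, f (pre x n) ∂ν - n * meanGrowth f ν| ≤ C) ∧
      Tendsto (fun n : ℕ => (1 / (n : ℝ)) * ∫ x, f (pre x n) ∂ν) atTop (𝓝 (meanGrowth f ν)) := by
  have := hν.1
  have key : ∀ m n, |∫ x, f (pre x (m + n)) ∂ν -
      (∫ x, f (pre x m) ∂ν + ∫ x, f (pre x n) ∂ν)| ≤ C := by
    intro m n
    have hi := integrable_pre ν n f
    have hi' : Integrable (fun x => f (pre (shift^[m] x) n)) ν := by
      have h := hν.2.iterate m
      exact h.integrable_comp_of_integrable hi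
    rw [← hν.integral_pre_shift m n, ← integral_add (integrable_pre ν m f) hi',
      ← integral_sub (integrable_pre ν _ f)
        (g := fun x => f (pre x m) + f (pre (shift^[m] x) n)) ((integrable_pre ν m f).add hi')]
    have := norm_integral_le_of_norm_le_const (μ := ν) (C := C)
      (f := fun x => f (pre x (m + n)) - (f (pre x m) + f (pre (shift^[m] x) n)))
      (Eventually.of_forall fun x => by
        rw [pre_add]
        exact hf _ _)
    simpa using this
  obtain ⟨L, h1, h2⟩ := exists_lim_of_almost_additive (a := fun n => ∫ x, f (pre x n) ∂ν) key
  have : meanGrowth f ν = L := h2.limUnder_eq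
  rw [this]
  exact ⟨h1, h2⟩

lemma meanGrowth_const_mul_add (hf : AlmostAdditive C f) (hg : AlmostAdditive D g)
    (hν : IsInvariant ν) (a b : ℝ) :
    meanGrowth (fun w => a * f w + b * g w) ν = a * meanGrowth f ν + b * meanGrowth g ν := by
  have := hν.1
  refine Tendsto.limUnder_eq ?_
  refine (((hf.meanGrowth_spec hν).2.const_mul a).add
    ((hg.meanGrowth_spec hν).2.const_mul b)).congr fun n => ?_
  rw [integral_add ((integrable_pre ν n f).const_mul a) ((integrable_pre ν n g).const_mul b),
    integral_const_mul, integral_const_mul]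
  ring

lemma meanGrowth_le (hf : AlmostAdditive C f) (hg : AlmostAdditive D g) (hν : IsInvariant ν)
    {k B : ℝ} (h : ∀ w, f w ≤ g w + w.length * k + B) :
    meanGrowth f ν ≤ meanGrowth g ν + k := by
  have := hν.1
  refine le_of_forall_nat_mul_le (D := B + C + D) fun n => ?_
  have h1 := (abs_le.1 ((hf.meanGrowth_spec hν).1 n)).1
  have h2 := (abs_le.1 ((hg.meanGrowth_spec hν).1 n)).2
  have h3 : ∫ x, f (pre x n) ∂ν ≤ ∫ x, (g (pre x n) + (n * k + B)) ∂ν := by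
    refine integral_mono (integrable_pre ν n f)
      ((integrable_pre ν n g).add (integrable_const _)) fun x => ?_
    have := h (pre x n)
    simp only [pre, List.length_ofFn] at this ⊢
    linarith
  rw [integral_add (integrable_pre ν n g) (integrable_const _), integral_const] at h3
  simp only [probReal_univ, one_smul] at h3
  linarith

end AlmostAdditive

lemma meanGrowth_zero (ν : Measure (ℕ → Fin N)) : meanGrowth (fun _ => 0) ν = 0 := by
  refine Tendsto.limUnder_eq ?_
  simp

/-! ### Pressure -/

/-- The partition sum of `e^f` over the words of length `n`. -/
noncomputable def partitionSum (f : List (Fin N) → ℝ) (n : ℕ) : ℝ :=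
  ∑ w : Fin n → Fin N, Real.exp (f (List.ofFn w))

/-- The pressure of `e^f`. -/
noncomputable def logPressure (f : List (Fin N) → ℝ) : ℝ :=
  pressure fun w => Real.exp (f w)

lemma partitionSum_pos [Nonempty (Fin N)] (f : List (Fin N) → ℝ) (n : ℕ) :
    0 < partitionSum f n :=
  Finset.sum_pos (fun _ _ => Real.exp_pos _) Finset.univ_nonempty

/-- The sum of `e^f` over the right extensions of a word. -/
lemma AlmostAdditive.sum_exp_append_mem {C : ℝ} {f : List (Fin N) → ℝ} (hf : AlmostAdditive C f)
    (u : List (Fin N)) (n : ℕ) :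
    ∑ v : Fin n → Fin N, Real.exp (f (u ++ List.ofFn v)) ∈
      Set.Icc (Real.exp (-C) * (Real.exp (f u) * partitionSum f n))
        (Real.exp C * (Real.exp (f u) * partitionSum f n)) := by
  simp only [partitionSum, Finset.mul_sum, ← Real.exp_add]
  constructor <;>
  · refine Finset.sum_le_sum fun v _ => Real.exp_le_exp.2 ?_
    have := abs_le.1 (hf u (List.ofFn v))
    linarith

/-- The sum of `e^f` over the left extensions of a word. -/
lemma AlmostAdditive.sum_exp_append_left_mem {C : ℝ} {f : List (Fin N) → ℝ}
    (hf : AlmostAdditive C f) (v : List (Fin N)) (n : ℕ) :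
    ∑ u : Fin n → Fin N, Real.exp (f (List.ofFn u ++ v)) ∈
      Set.Icc (Real.exp (-C) * (Real.exp (f v) * partitionSum f n))
        (Real.exp C * (Real.exp (f v) * partitionSum f n)) := by
  simp only [partitionSum, Finset.mul_sum, ← Real.exp_add]
  constructor <;>
  · refine Finset.sum_le_sum fun u _ => Real.exp_le_exp.2 ?_
    have := abs_le.1 (hf (List.ofFn u) v)
    linarith

namespace AlmostAdditive

variable [Nonempty (Fin N)] {C D : ℝ} {f g : List (Fin N) → ℝ}

/-- The limit defining the pressure exists, and the logarithms of the partition sums stay at bounded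
distance from linear growth. -/
lemma logPressure_spec (hf : AlmostAdditive C f) (n : ℕ) :
    |Real.log (partitionSum f n) - n * logPressure f| ≤ C := by
  have key : ∀ m n, |Real.log (partitionSum f (m + n)) -
      (Real.log (partitionSum f m) + Real.log (partitionSum f n))| ≤ C := by
    intro m n
    have hm := partitionSum_pos f m
    have hn := partitionSum_pos f n
    have hs : partitionSum f (m + n) =
        ∑ u : Fin m → Fin N, ∑ v : Fin n → Fin N, Real.exp (f (List.ofFn u ++ List.ofFn v)) :=
      sum_words_add m n fun w => Real.exp (f w)
    have hmul : partitionSum f m * partitionSum f n =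
        ∑ u : Fin m → Fin N, Real.exp (f (List.ofFn u)) * partitionSum f n := by
      rw [← Finset.sum_mul, partitionSum]
    have h1 : Real.exp (-C) * (partitionSum f m * partitionSum f n) ≤ partitionSum f (m + n) := by
      rw [hs, hmul, Finset.mul_sum]
      exact Finset.sum_le_sum fun u _ => (hf.sum_exp_append_mem _ n).1
    have h2 : partitionSum f (m + n) ≤ Real.exp C * (partitionSum f m * partitionSum f n) := by
      rw [hs, hmul, Finset.mul_sum]
      exact Finset.sum_le_sum fun u _ => (hf.sum_exp_append_mem _ n).2
    have h1' := Real.log_le_log (by positivity) h1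
    have h2' := Real.log_le_log (partitionSum_pos f _) h2
    rw [Real.log_mul (Real.exp_pos _).ne' (by positivity), Real.log_mul hm.ne' hn.ne',
      Real.log_exp] at h1' h2'
    rw [abs_le]
    constructor <;> linarith
  obtain ⟨L, h1, h2⟩ := exists_lim_of_almost_additive
    (a := fun n => Real.log (partitionSum f n)) key
  have : logPressure f = L := h2.limUnder_eq
  rw [this]
  exact h1 n

lemma logPressure_le (hf : AlmostAdditive C f) (hg : AlmostAdditive D g)
    {k B : ℝ} (h : ∀ w, f w ≤ g w + w.length * k + B) :
    logPressure f ≤ logPressure g + k := by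
  refine le_of_forall_nat_mul_le (D := B + C + D) fun n => ?_
  have h1 := (abs_le.1 (hf.logPressure_spec n)).1
  have h2 := (abs_le.1 (hg.logPressure_spec n)).2
  have h3 : partitionSum f n ≤ Real.exp (n * k + B) * partitionSum g n := by
    simp only [partitionSum, Finset.mul_sum, ← Real.exp_add]
    refine Finset.sum_le_sum fun w _ => Real.exp_le_exp.2 ?_
    have := h (List.ofFn w)
    rw [List.length_ofFn] at this
    linarith
  have h4 := Real.log_le_log (partitionSum_pos f n) h3
  rw [Real.log_mul (Real.exp_pos _).ne' (partitionSum_pos g n).ne', Real.log_exp] at h4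
  linarith

lemma logPressure_add_length (hf : AlmostAdditive C f) (a : ℝ) :
    logPressure (fun w => f w + w.length * a) = logPressure f + a := by
  refine le_antisymm ?_ ?_
  · exact (hf.add_length a).logPressure_le hf (B := 0) fun w => by simp
  · have := hf.logPressure_le (hf.add_length a) (k := -a) (B := 0) fun w => by simp
    linarith

end AlmostAdditive

/-! ### Entropy and the variational inequality -/

/-- **Gibbs' inequality** for weights of arbitrary total mass. -/
lemma sum_mul_log_sub_log_le {ι : Type*} [Fintype ι] {p z : ι → ℝ} (hp : ∀ i, 0 ≤ p i)
    (hp1 : ∑ i, p i = 1) (hz : ∀ i, 0 ≤ z i) (hpz : ∀ i, p i ≠ 0 → z i ≠ 0) :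
    ∑ i, p i * (Real.log (z i) - Real.log (p i)) ≤ Real.log (∑ i, z i) := by
  have hZ : 0 < ∑ i, z i := by
    obtain ⟨i, -, hi⟩ := Finset.exists_ne_zero_of_sum_ne_zero (hp1.trans_ne one_ne_zero)
    exact Finset.sum_pos' (fun i _ => hz i)
      ⟨i, Finset.mem_univ i, lt_of_le_of_ne (hz i) (hpz i hi).symm⟩
  set Z := ∑ i, z i
  have hterm : ∀ i, p i * (Real.log (z i) - Real.log (p i)) ≤ p i * Real.log Z + z i / Z - p i := by
    intro i
    rcases eq_or_ne (p i) 0 with h0 | h0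
    · rw [h0]
      have := div_nonneg (hz i) hZ.le
      simpa using this
    · have hpi : 0 < p i := lt_of_le_of_ne (hp i) h0.symm
      have hzi : 0 < z i := lt_of_le_of_ne (hz i) (hpz i h0).symm
      have h := Real.log_le_sub_one_of_pos (x := z i / (p i * Z)) (by positivity)
      rw [Real.log_div hzi.ne' (by positivity), Real.log_mul h0 hZ.ne'] at h
      have h' := mul_le_mul_of_nonneg_left h hpi.le
      have e : p i * (z i / (p i * Z) - 1) = z i / Z - p i := by field_simp
      rw [e] at h'
      linarith
  calc _ ≤ ∑ i, (p i * Real.log Z + z i / Z - p i) := Finset.sum_le_sum fun i _ => hterm i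
    _ = Real.log Z := by
      rw [Finset.sum_sub_distrib, Finset.sum_add_distrib, ← Finset.sum_mul, ← Finset.sum_div, hp1,
        div_self hZ.ne']
      ring

/-- The entropy of the partition into cylinders of length `n`. -/
noncomputable def blockEntropy (ν : Measure (ℕ → Fin N)) (n : ℕ) : ℝ :=
  -∑ w : Fin n → Fin N, ν.real (cyl (List.ofFn w)) * Real.log (ν.real (cyl (List.ofFn w)))

lemma real_cyl_append_ne_zero {ν : Measure (ℕ → Fin N)} (hν : IsInvariant ν) {u v : List (Fin N)}
    (h : ν.real (cyl (u ++ v)) ≠ 0) : ν.real (cyl u) ≠ 0 ∧ ν.real (cyl v) ≠ 0 := by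
  have := hν.1
  have hpos : 0 < ν.real (cyl (u ++ v)) := lt_of_le_of_ne measureReal_nonneg h.symm
  rw [cyl_append] at hpos
  constructor
  · exact (hpos.trans_le (measureReal_mono Set.inter_subset_left)).ne'
  · rw [← hν.real_preimage u.length (measurableSet_cyl v)]
    exact (hpos.trans_le (measureReal_mono Set.inter_subset_right)).ne'

lemma IsInvariant.sum_real_cyl_append_left {ν : Measure (ℕ → Fin N)} (hν : IsInvariant ν) (n : ℕ)
    (v : List (Fin N)) :
    ∑ u : Fin n → Fin N, ν.real (cyl (List.ofFn u ++ v)) = ν.real (cyl v) := by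
  have := hν.1
  rw [SelfAffine.sum_real_cyl_append_left, hν.real_preimage n (measurableSet_cyl v)]

/-- Block entropies of an invariant measure are subadditive: Gibbs' inequality for the weights
`ν[u] ν[v]` on the words `uv`. -/
lemma IsInvariant.blockEntropy_add_le {ν : Measure (ℕ → Fin N)} (hν : IsInvariant ν) (m n : ℕ) :
    blockEntropy ν (m + n) ≤ blockEntropy ν m + blockEntropy ν n := by
  have := hν.1
  have h := sum_mul_log_sub_log_le (ι := (Fin m → Fin N) × (Fin n → Fin N))
    (p := fun x => ν.real (cyl (List.ofFn x.1 ++ List.ofFn x.2)))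
    (z := fun x => ν.real (cyl (List.ofFn x.1)) * ν.real (cyl (List.ofFn x.2)))
    (fun _ => measureReal_nonneg)
    (by simp_rw [Fintype.sum_prod_type, sum_real_cyl_append_right, sum_real_cyl])
    (fun _ => by positivity)
    (fun x hx => mul_ne_zero (real_cyl_append_ne_zero hν hx).1 (real_cyl_append_ne_zero hν hx).2)
  rw [Fintype.sum_prod_type (f := fun x : (Fin m → Fin N) × (Fin n → Fin N) =>
    ν.real (cyl (List.ofFn x.1)) * ν.real (cyl (List.ofFn x.2)))] at h
  simp only [← Finset.mul_sum, sum_real_cyl, mul_one, Real.log_one] at h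
  have e1 : ∀ x : (Fin m → Fin N) × (Fin n → Fin N),
      ν.real (cyl (List.ofFn x.1 ++ List.ofFn x.2)) *
        (Real.log (ν.real (cyl (List.ofFn x.1)) * ν.real (cyl (List.ofFn x.2))) -
          Real.log (ν.real (cyl (List.ofFn x.1 ++ List.ofFn x.2)))) =
      ν.real (cyl (List.ofFn x.1 ++ List.ofFn x.2)) * Real.log (ν.real (cyl (List.ofFn x.1))) +
      ν.real (cyl (List.ofFn x.1 ++ List.ofFn x.2)) * Real.log (ν.real (cyl (List.ofFn x.2))) -
      ν.real (cyl (List.ofFn x.1 ++ List.ofFn x.2)) *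
        Real.log (ν.real (cyl (List.ofFn x.1 ++ List.ofFn x.2))) := by
    intro x
    rcases eq_or_ne (ν.real (cyl (List.ofFn x.1 ++ List.ofFn x.2))) 0 with h0 | h0
    · simp [h0]
    · obtain ⟨h1, h2⟩ := real_cyl_append_ne_zero hν h0
      rw [Real.log_mul h1 h2]
      ring
  rw [Finset.sum_congr rfl fun x _ => e1 x, Finset.sum_sub_distrib, Finset.sum_add_distrib,
    Fintype.sum_prod_type, Fintype.sum_prod_type_right, Fintype.sum_prod_type] at h
  simp only [← Finset.sum_mul, sum_real_cyl_append_right, hν.sum_real_cyl_append_left] at h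
  have hs := sum_words_add m n fun w => ν.real (cyl w) * Real.log (ν.real (cyl w))
  simp only [blockEntropy]
  rw [hs]
  linarith

lemma blockEntropy_nonneg (ν : Measure (ℕ → Fin N)) [IsProbabilityMeasure ν] (n : ℕ) :
    0 ≤ blockEntropy ν n := by
  rw [blockEntropy, neg_nonneg]
  exact Finset.sum_nonpos fun w _ => mul_nonpos_of_nonneg_of_nonpos measureReal_nonneg
    (Real.log_nonpos measureReal_nonneg measureReal_le_one)

/-- The limit defining the entropy exists, and it is the infimum of the averaged block entropies. -/
lemma IsInvariant.entropy_spec {ν : Measure (ℕ → Fin N)} (hν : IsInvariant ν) :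
    (∀ n : ℕ, n * entropy ν ≤ blockEntropy ν n) ∧
      Tendsto (fun n : ℕ => 1 / (n : ℝ) * blockEntropy ν n) atTop (𝓝 (entropy ν)) := by
  have := hν.1
  have hsub : Subadditive (blockEntropy ν) := fun m n => hν.blockEntropy_add_le m n
  have hbdd : BddBelow (Set.range fun n : ℕ => blockEntropy ν n / n) := by
    refine ⟨0, ?_⟩
    rintro _ ⟨n, rfl⟩
    exact div_nonneg (blockEntropy_nonneg ν n) (Nat.cast_nonneg n)
  have hT : Tendsto (fun n : ℕ => 1 / (n : ℝ) * blockEntropy ν n) atTop (𝓝 hsub.lim) :=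
    (hsub.tendsto_lim hbdd).congr fun n => by ring
  have he : entropy ν = hsub.lim := by
    rw [entropy, neg_eq_iff_eq_neg]
    refine Tendsto.limUnder_eq (hT.neg.congr fun n => ?_)
    rw [blockEntropy]
    ring
  rw [he]
  refine ⟨fun n => ?_, hT⟩
  rcases Nat.eq_zero_or_pos n with rfl | hn
  · simpa using blockEntropy_nonneg ν 0
  · have := hsub.lim_le_div hbdd hn.ne'
    rw [le_div_iff₀ (by exact_mod_cast hn)] at this
    linarith

lemma le_entropy_of_forall_le {ν : Measure (ℕ → Fin N)} (hν : IsInvariant ν) {h D : ℝ}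
    (H : ∀ n : ℕ, n * h ≤ blockEntropy ν n + D) : h ≤ entropy ν := by
  have h1 := hν.entropy_spec.2.add (tendsto_const_div_atTop_nhds_zero_nat D)
  rw [add_zero] at h1
  refine ge_of_tendsto h1 ?_
  filter_upwards [eventually_gt_atTop 0] with n hn
  have hn' : (0 : ℝ) < n := by exact_mod_cast hn
  rw [show 1 / (n : ℝ) * blockEntropy ν n + D / n = (blockEntropy ν n + D) / n by ring,
    le_div_iff₀ hn']
  linarith [H n]

lemma blockEntropy_add_integral_le (ν : Measure (ℕ → Fin N)) [IsProbabilityMeasure ν]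
    (f : List (Fin N) → ℝ) (n : ℕ) :
    blockEntropy ν n + ∫ x, f (pre x n) ∂ν ≤ Real.log (partitionSum f n) := by
  have h := sum_mul_log_sub_log_le (p := fun w : Fin n → Fin N => ν.real (cyl (List.ofFn w)))
    (z := fun w => Real.exp (f (List.ofFn w))) (fun _ => measureReal_nonneg) (sum_real_cyl ν n)
    (fun _ => (Real.exp_pos _).le) (fun _ _ => (Real.exp_pos _).ne')
  simp only [Real.log_exp, mul_sub, Finset.sum_sub_distrib] at h
  rw [integral_pre, blockEntropy, partitionSum]
  linarith

/-- The variational inequality `h(ν) + Λ(e^f, ν) ≤ P(e^f)`. -/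
lemma AlmostAdditive.entropy_add_meanGrowth_le [Nonempty (Fin N)] {C : ℝ} {f : List (Fin N) → ℝ}
    (hf : AlmostAdditive C f) {ν : Measure (ℕ → Fin N)} (hν : IsInvariant ν) :
    entropy ν + meanGrowth f ν ≤ logPressure f := by
  have := hν.1
  refine le_of_forall_nat_mul_le (D := C + C) fun n => ?_
  have h1 := hν.entropy_spec.1 n
  have h2 := (abs_le.1 ((hf.meanGrowth_spec hν).1 n)).1
  have h3 := (abs_le.1 (hf.logPressure_spec n)).2
  have h4 := blockEntropy_add_integral_le ν f n
  linarith

/-! ### Comparison of measures on cylinders -/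

lemma measureReal_le_add_symmDiff (m : Measure (ℕ → Fin N)) [IsFiniteMeasure m]
    (T E : Set (ℕ → Fin N)) : m.real E ≤ m.real T + m.real (symmDiff T E) := by
  refine (measureReal_mono fun x hx => ?_).trans (measureReal_union_le _ _)
  by_cases hxT : x ∈ T
  · exact Or.inl hxT
  · exact Or.inr (Or.inr ⟨hx, hxT⟩)

/-- An inequality between finite measures on cylinders extends to all measurable sets. -/
lemma measureReal_le_of_cyl_le {m₁ m₂ : Measure (ℕ → Fin N)} [IsFiniteMeasure m₁]
    [IsFiniteMeasure m₂] (h : ∀ w, m₁.real (cyl w) ≤ m₂.real (cyl w)) {E : Set (ℕ → Fin N)}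
    (hE : MeasurableSet E) : m₁.real E ≤ m₂.real E := by
  refine le_of_forall_pos_le_add fun ε hε => ?_
  obtain ⟨n, S, hS⟩ := exists_res_approx (m₁ + m₂) hE hε
  rw [measureReal_add_apply] at hS
  have h1 : m₁.real E ≤ m₁.real (res n ⁻¹' S) + m₁.real (symmDiff (res n ⁻¹' S) E) :=
    measureReal_le_add_symmDiff _ _ _
  have h2 : m₂.real (res n ⁻¹' S) ≤ m₂.real E + m₂.real (symmDiff (res n ⁻¹' S) E) := by
    rw [symmDiff_comm]
    exact measureReal_le_add_symmDiff _ _ _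
  have h3 : m₁.real (res n ⁻¹' S) ≤ m₂.real (res n ⁻¹' S) := by
    rw [real_preimage_res, real_preimage_res]
    exact Finset.sum_le_sum fun w _ => h _
  linarith

/-- Absolute continuity may be checked, uniformly, on finite unions of cylinders. -/
lemma absolutelyContinuous_of_res {η ν : Measure (ℕ → Fin N)} [IsFiniteMeasure η]
    [IsFiniteMeasure ν]
    (h : ∀ ε > 0, ∃ δ > 0, ∀ (n : ℕ) (S : Finset (Fin n → Fin N)),
      ν.real (res n ⁻¹' S) ≤ δ → η.real (res n ⁻¹' S) ≤ ε) : η ≪ ν := by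
  refine Measure.AbsolutelyContinuous.mk fun E hE hνE => ?_
  have hν0 : ν.real E = 0 := by rw [Measure.real, hνE, ENNReal.toReal_zero]
  suffices η.real E = 0 from (measureReal_eq_zero_iff).1 this
  refine le_antisymm (le_of_forall_pos_le_add fun ε hε => ?_) measureReal_nonneg
  obtain ⟨δ, hδ, H⟩ := h (ε / 2) (half_pos hε)
  obtain ⟨n, S, hS⟩ := exists_res_approx (η + ν) hE (lt_min hδ (half_pos hε))
  rw [measureReal_add_apply] at hS
  have hS1 := hS.trans_le (min_le_left _ _)
  have hS2 := hS.trans_le (min_le_right _ _)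
  have p1 : 0 ≤ ν.real (symmDiff (res n ⁻¹' S) E) := measureReal_nonneg
  have p2 : 0 ≤ η.real (symmDiff (res n ⁻¹' S) E) := measureReal_nonneg
  have h1 : η.real E ≤ η.real (res n ⁻¹' S) + η.real (symmDiff (res n ⁻¹' S) E) :=
    measureReal_le_add_symmDiff _ _ _
  have h2 : ν.real (res n ⁻¹' S) ≤ ν.real E + ν.real (symmDiff (res n ⁻¹' S) E) := by
    rw [symmDiff_comm]
    exact measureReal_le_add_symmDiff _ _ _
  have h3 := H n S (by linarith)
  linarith

/-! ### Gibbs measures -/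

/-- Any probability vector on the words of length `L` is the distribution of the first `L` letters
of some infinite random word. -/
lemma exists_measure_of_weights [Nonempty (Fin N)] {L : ℕ} {c : (Fin L → Fin N) → ℝ}
    (hc : ∀ w, 0 ≤ c w) (hc1 : ∑ w, c w = 1) :
    ∃ m : Measure (ℕ → Fin N), IsProbabilityMeasure m ∧
      ∀ w : Fin L → Fin N, m.real (cyl (List.ofFn w)) = c w := by
  classical
  let e : (Fin L → Fin N) → ℕ → Fin N := fun w k =>
    if h : k < L then w ⟨k, h⟩ else Classical.arbitrary _
  have he : ∀ w, res L (e w) = w := by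
    intro w
    funext k
    simp [res, e]
  refine ⟨∑ w, ENNReal.ofReal (c w) • Measure.dirac (e w), ⟨?_⟩, fun w => ?_⟩
  · simp only [Measure.coe_finsetSum, Finset.sum_apply, Measure.smul_apply, measure_univ,
      smul_eq_mul, mul_one]
    rw [← ENNReal.ofReal_sum_of_nonneg fun w _ => hc w, hc1, ENNReal.ofReal_one]
  · rw [Measure.real]
    simp only [Measure.coe_finsetSum, Finset.sum_apply, Measure.smul_apply, smul_eq_mul]
    rw [Finset.sum_eq_single w]
    · rw [Measure.dirac_apply' _ (measurableSet_cyl _), cyl_ofFn, Set.indicator_of_mem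
        (show e w ∈ res L ⁻¹' {w} from he w)]
      simp [hc w]
    · intro v _ hv
      rw [Measure.dirac_apply' _ (measurableSet_cyl _), cyl_ofFn, Set.indicator_of_notMem]
      · simp
      · simpa [he] using hv
    · simp

namespace AlmostAdditive

variable [Nonempty (Fin N)] {C : ℝ} {f : List (Fin N) → ℝ}

lemma partitionSum_mem (hf : AlmostAdditive C f) (hP : logPressure f = 0) (n : ℕ) :
    partitionSum f n ∈ Set.Icc (Real.exp (-C)) (Real.exp C) := by
  have h := abs_le.1 (hf.logPressure_spec n)
  rw [hP, mul_zero, sub_zero, Real.le_log_iff_exp_le (partitionSum_pos f n),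
    Real.log_le_iff_le_exp (partitionSum_pos f n)] at h
  exact h

/-- A Gibbs measure for `e^f`, possibly not shift-invariant: a limit, as `L → ∞`, of measures that
give each word `w` of length `L` the mass `e^{f(w)} / Z_L`. -/
lemma exists_gibbs_measure (hf : AlmostAdditive C f) (hP : logPressure f = 0) :
    ∃ m : Measure (ℕ → Fin N), IsProbabilityMeasure m ∧ ∀ w, m.real (cyl w) ∈
      Set.Icc (Real.exp (f w - 3 * C)) (Real.exp (f w + 3 * C)) := by
  have hex : ∀ L : ℕ, ∃ m : Measure (ℕ → Fin N), IsProbabilityMeasure m ∧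
      ∀ w : Fin L → Fin N, m.real (cyl (List.ofFn w)) =
        Real.exp (f (List.ofFn w)) / partitionSum f L := fun L =>
    exists_measure_of_weights (fun w => div_nonneg (Real.exp_pos _).le (partitionSum_pos f L).le)
      (by rw [← Finset.sum_div]; exact div_self (partitionSum_pos f L).ne')
  choose m hm hmc using hex
  have hmc' : ∀ w : List (Fin N), (m w.length).real (cyl w) =
      Real.exp (f w) / partitionSum f w.length := by
    intro w
    have := hmc w.length w.get
    rwa [List.ofFn_get] at this
  obtain ⟨η, hη, hηt⟩ := exists_tendsto_cyl (Ultrafilter.of atTop) m hm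
  refine ⟨η, hη, fun w => ?_⟩
  refine isClosed_Icc.mem_of_tendsto (hηt w) (Ultrafilter.of_le atTop ?_)
  filter_upwards [eventually_ge_atTop w.length] with L hL
  obtain ⟨n, rfl⟩ := Nat.exists_eq_add_of_le hL
  have hs : (m (w.length + n)).real (cyl w) =
      (∑ v : Fin n → Fin N, Real.exp (f (w ++ List.ofFn v))) / partitionSum f (w.length + n) := by
    rw [← sum_real_cyl_append_right _ n w, Finset.sum_div]
    refine Finset.sum_congr rfl fun v _ => ?_
    have := hmc' (w ++ List.ofFn v)
    rwa [List.length_append, List.length_ofFn] at this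
  have h1 := hf.sum_exp_append_mem w n
  have h2 := hf.partitionSum_mem hP n
  have h3 := hf.partitionSum_mem hP (w.length + n)
  have hpos := partitionSum_pos f (w.length + n)
  rw [hs]
  constructor
  · rw [le_div_iff₀ hpos]
    calc Real.exp (f w - 3 * C) * partitionSum f (w.length + n)
        ≤ Real.exp (f w - 3 * C) * Real.exp C := by gcongr; exact h3.2
      _ = Real.exp (-C) * (Real.exp (f w) * Real.exp (-C)) := by
        simp only [← Real.exp_add]; congr 1; ring
      _ ≤ Real.exp (-C) * (Real.exp (f w) * partitionSum f n) := by gcongr; exact h2.1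
      _ ≤ _ := h1.1
  · rw [div_le_iff₀ hpos]
    calc _ ≤ Real.exp C * (Real.exp (f w) * partitionSum f n) := h1.2
      _ ≤ Real.exp C * (Real.exp (f w) * Real.exp C) := by gcongr; exact h2.2
      _ = Real.exp (f w + 3 * C) * Real.exp (-C) := by
        simp only [← Real.exp_add]; congr 1; ring
      _ ≤ _ := by gcongr; exact h3.1

/-- An invariant Gibbs measure: a limit of the averages of a Gibbs measure along the shift. -/
lemma exists_invariant_gibbs (hf : AlmostAdditive C f) (hP : logPressure f = 0) :
    ∃ ν : Measure (ℕ → Fin N), IsInvariant ν ∧ ∀ w, ν.real (cyl w) ∈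
      Set.Icc (Real.exp (f w - 5 * C)) (Real.exp (f w + 5 * C)) := by
  obtain ⟨m, hm, hmg⟩ := hf.exists_gibbs_measure hP
  -- the Gibbs bounds survive the shift, with a constant that does not depend on the iterate
  have hshift : ∀ (a : ℕ) (w : List (Fin N)), m.real (shift^[a] ⁻¹' cyl w) ∈
      Set.Icc (Real.exp (f w - 5 * C)) (Real.exp (f w + 5 * C)) := by
    intro a w
    have h1 := hf.sum_exp_append_left_mem w a
    have h2 := hf.partitionSum_mem hP a
    rw [← sum_real_cyl_append_left]
    constructor
    · calc Real.exp (f w - 5 * C)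
          = Real.exp (-(3 * C)) * (Real.exp (-C) * (Real.exp (f w) * Real.exp (-C))) := by
            simp only [← Real.exp_add]; congr 1; ring
        _ ≤ Real.exp (-(3 * C)) * (Real.exp (-C) * (Real.exp (f w) * partitionSum f a)) := by
            gcongr; exact h2.1
        _ ≤ Real.exp (-(3 * C)) * ∑ u : Fin a → Fin N, Real.exp (f (List.ofFn u ++ w)) := by
            gcongr; exact h1.1
        _ ≤ _ := by
            rw [Finset.mul_sum]
            refine Finset.sum_le_sum fun u _ => ?_
            rw [← Real.exp_add, neg_add_eq_sub]
            exact (hmg _).1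
    · calc _ ≤ Real.exp (3 * C) * ∑ u : Fin a → Fin N, Real.exp (f (List.ofFn u ++ w)) := by
            rw [Finset.mul_sum]
            refine Finset.sum_le_sum fun u _ => ?_
            rw [← Real.exp_add, add_comm]
            exact (hmg _).2
        _ ≤ Real.exp (3 * C) * (Real.exp C * (Real.exp (f w) * partitionSum f a)) := by
            gcongr; exact h1.2
        _ ≤ Real.exp (3 * C) * (Real.exp C * (Real.exp (f w) * Real.exp C)) := by
            gcongr; exact h2.2
        _ = _ := by simp only [← Real.exp_add]; congr 1; ring
  let avg : ℕ → Measure (ℕ → Fin N) := fun L =>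
    ENNReal.ofReal (1 / ((L : ℝ) + 1)) • ∑ a ∈ Finset.range (L + 1), m.map shift^[a]
  have havg : ∀ (L : ℕ) {E : Set (ℕ → Fin N)}, MeasurableSet E → (avg L).real E =
      1 / ((L : ℝ) + 1) * ∑ a ∈ Finset.range (L + 1), m.real (shift^[a] ⁻¹' E) := by
    intro L E hE
    have hL : (0 : ℝ) ≤ 1 / ((L : ℝ) + 1) := by positivity
    simp only [avg]
    rw [measureReal_ennreal_smul_apply, ENNReal.toReal_ofReal hL, Measure.real,
      Measure.finsetSum_apply, ENNReal.toReal_sum fun a _ => by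
        rw [Measure.map_apply (measurable_shift.iterate a) hE]; exact measure_ne_top _ _]
    congr 1
    refine Finset.sum_congr rfl fun a _ => ?_
    rw [Measure.map_apply (measurable_shift.iterate a) hE, Measure.real]
  have havgp : ∀ L, IsProbabilityMeasure (avg L) := by
    intro L
    have hfin : IsFiniteMeasure (avg L) :=
      Measure.smul_finite _ ENNReal.ofReal_ne_top
    have := havg L MeasurableSet.univ
    simp only [Set.preimage_univ, probReal_univ, Finset.sum_const, Finset.card_range,
      nsmul_eq_mul, mul_one, Nat.cast_add, Nat.cast_one] at this
    rw [one_div, inv_mul_cancel₀ (by positivity)] at this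
    refine ⟨?_⟩
    rw [← ENNReal.ofReal_toReal (measure_ne_top (avg L) _)]
    simp [← Measure.real_def, this]
  obtain ⟨ν, hν, hνt⟩ := exists_tendsto_cyl (Ultrafilter.of atTop) avg havgp
  refine ⟨ν, ⟨hν, measurable_shift, ?_⟩, fun w => ?_⟩
  · have : IsProbabilityMeasure (ν.map shift) :=
      Measure.isProbabilityMeasure_map measurable_shift.aemeasurable
    refine ext_of_cyl fun w => ?_
    rw [map_measureReal_apply measurable_shift (measurableSet_cyl w)]
    have h1 : Tendsto (fun L => (avg L).real (shift ⁻¹' cyl w))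
        (Ultrafilter.of atTop : Ultrafilter ℕ) (𝓝 (ν.real (shift ⁻¹' cyl w))) := by
      have e : ∀ (κ : Measure (ℕ → Fin N)) [IsFiniteMeasure κ],
          κ.real (shift ⁻¹' cyl w) = ∑ u : Fin 1 → Fin N, κ.real (cyl (List.ofFn u ++ w)) :=
        fun κ _ => (sum_real_cyl_append_left κ 1 w).symm
      rw [e]
      simp_rw [e]
      exact tendsto_finsetSum _ fun u _ => hνt _
    -- the two averages differ by two boundary terms of weight `1 / (L + 1)`
    have h2 : Tendsto (fun L => (avg L).real (shift ⁻¹' cyl w) - (avg L).real (cyl w))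
        (Ultrafilter.of atTop : Ultrafilter ℕ) (𝓝 0) := by
      refine Tendsto.mono_left ?_ (Ultrafilter.of_le atTop)
      refine squeeze_zero_norm (fun L => ?_) tendsto_one_div_add_atTop_nhds_zero_nat
      rw [havg L (measurable_shift (measurableSet_cyl w)), havg L (measurableSet_cyl w), ← mul_sub,
        ← Finset.sum_sub_distrib, Real.norm_eq_abs, abs_mul, abs_of_nonneg (by positivity)]
      have hpre : ∀ a : ℕ, shift^[a] ⁻¹' (shift ⁻¹' cyl w) = shift^[a + 1] ⁻¹' cyl w := by
        intro a
        rw [← Set.preimage_comp, ← Function.iterate_succ']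
      simp_rw [hpre]
      rw [Finset.sum_range_sub fun a => m.real (shift^[a] ⁻¹' cyl w)]
      refine mul_le_of_le_one_right (by positivity) ?_
      rw [abs_le]
      have i1 : m.real (shift^[L + 1] ⁻¹' cyl w) ≤ 1 := measureReal_le_one
      have i2 : m.real (shift^[0] ⁻¹' cyl w) ≤ 1 := measureReal_le_one
      have i3 : 0 ≤ m.real (shift^[L + 1] ⁻¹' cyl w) := measureReal_nonneg
      have i4 : 0 ≤ m.real (shift^[0] ⁻¹' cyl w) := measureReal_nonneg
      constructor <;> linarith
    exact sub_eq_zero.1 (tendsto_nhds_unique (h1.sub (hνt w)) h2)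
  · refine isClosed_Icc.mem_of_tendsto (hνt w) (Eventually.of_forall fun L => ?_)
    rw [havg L (measurableSet_cyl w), one_div, inv_mul_eq_div]
    have hL : (0 : ℝ) < (L : ℝ) + 1 := by positivity
    constructor
    · rw [le_div_iff₀ hL]
      have := Finset.card_nsmul_le_sum (Finset.range (L + 1)) _ _ fun a _ => (hshift a w).1
      simp only [Finset.card_range, nsmul_eq_mul, Nat.cast_add, Nat.cast_one] at this
      linarith
    · rw [div_le_iff₀ hL]
      have := Finset.sum_le_card_nsmul (Finset.range (L + 1)) _ _ fun a _ => (hshift a w).2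
      simp only [Finset.card_range, nsmul_eq_mul, Nat.cast_add, Nat.cast_one] at this
      linarith

end AlmostAdditive

/-- An invariant measure with `ν[uv] ≥ c ν[u] ν[v]` is ergodic: the inequality passes to
`ν(E ∩ B) ≥ c ν(E) ν(B)` for invariant `E` and measurable `B`, in particular for the complement
of `E`. -/
lemma IsInvariant.ergodic {ν : Measure (ℕ → Fin N)} (hν : IsInvariant ν) {c : ℝ} (hc : 0 < c)
    (h : ∀ u v, c * (ν.real (cyl u) * ν.real (cyl v)) ≤ ν.real (cyl (u ++ v))) :
    Ergodic shift ν := by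
  have := hν.1
  refine ⟨hν.2, ⟨fun E hE hinv => ?_⟩⟩
  have hiter : ∀ n : ℕ, shift^[n] ⁻¹' E = E := fun n => by
    induction n with
    | zero => rfl
    | succ n ih => rw [Function.iterate_succ, Set.preimage_comp, ih, hinv]
  have hcyl : ∀ u, c * ν.real (cyl u) * ν.real E ≤ ν.real (E ∩ cyl u) := by
    intro u
    have hs := measurable_shift (N := N).iterate u.length
    have : IsFiniteMeasure (ENNReal.ofReal (c * ν.real (cyl u)) • ν) :=
      Measure.smul_finite _ ENNReal.ofReal_ne_top
    have key := measureReal_le_of_cyl_le (m₁ := ENNReal.ofReal (c * ν.real (cyl u)) • ν)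
      (m₂ := (ν.restrict (cyl u)).map shift^[u.length]) (fun v => ?_) hE
    · rw [measureReal_ennreal_smul_apply, ENNReal.toReal_ofReal (by positivity),
        map_measureReal_apply hs hE, hiter, measureReal_restrict_apply hE] at key
      exact key
    · rw [measureReal_ennreal_smul_apply, ENNReal.toReal_ofReal (by positivity),
        map_measureReal_apply hs (measurableSet_cyl v),
        measureReal_restrict_apply (hs (measurableSet_cyl v)), Set.inter_comm, ← cyl_append]
      linarith [h u v]
  have : IsFiniteMeasure (ENNReal.ofReal (c * ν.real E) • ν) :=
    Measure.smul_finite _ ENNReal.ofReal_ne_top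
  have key := measureReal_le_of_cyl_le (m₁ := ENNReal.ofReal (c * ν.real E) • ν)
      (m₂ := ν.restrict E) (fun u => by
        rw [measureReal_ennreal_smul_apply, ENNReal.toReal_ofReal (by positivity),
          measureReal_restrict_apply (measurableSet_cyl u), Set.inter_comm]
        linarith [hcyl u]) hE.compl
  rw [measureReal_ennreal_smul_apply, ENNReal.toReal_ofReal (by positivity),
    measureReal_restrict_apply hE.compl, Set.compl_inter_self, measureReal_empty] at key
  have hz : c * ν.real E * ν.real Eᶜ = 0 := le_antisymm key (by positivity)
  rw [eventuallyConst_set']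
  rcases mul_eq_zero.1 hz with h0 | h0
  · left
    rw [ae_eq_empty]
    exact (measureReal_eq_zero_iff).1 ((mul_eq_zero.1 h0).resolve_left hc.ne')
  · right
    rw [ae_eq_univ]
    exact (measureReal_eq_zero_iff).1 h0

/-- If the relative entropies of `η` with respect to `ν` on the cylinder partitions are bounded,
then `η ≪ ν`. -/
lemma absolutelyContinuous_of_relEntropy_le {η ν : Measure (ℕ → Fin N)} [IsProbabilityMeasure η]
    [IsProbabilityMeasure ν] (hν : ∀ w, ν.real (cyl w) ≠ 0) {D : ℝ}
    (h : ∀ n, -∫ x, Real.log (ν.real (cyl (pre x n))) ∂η ≤ blockEntropy η n + D) : η ≪ ν := by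
  -- If `ν(S) ≤ 1 / a`, then Gibbs' inequality for the weights `ν` multiplied by `a` on `S` gives
  -- `η(S) log a ≤ D + log 2`.
  have key : ∀ (n : ℕ) (S : Finset (Fin n → Fin N)) (a : ℝ), 0 < a →
      ν.real (res n ⁻¹' S) ≤ 1 / a → η.real (res n ⁻¹' S) * Real.log a ≤ D + Real.log 2 := by
    classical
    intro n S a ha hS
    have hg := sum_mul_log_sub_log_le (p := fun w : Fin n → Fin N => η.real (cyl (List.ofFn w)))
      (z := fun w => (if w ∈ S then a else 1) * ν.real (cyl (List.ofFn w)))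
      (fun _ => measureReal_nonneg) (sum_real_cyl η n)
      (fun w => by split_ifs <;> positivity)
      (fun w _ => mul_ne_zero (by split_ifs <;> positivity) (hν _))
    have e1 : ∀ w : Fin n → Fin N, η.real (cyl (List.ofFn w)) *
        (Real.log ((if w ∈ S then a else 1) * ν.real (cyl (List.ofFn w))) -
          Real.log (η.real (cyl (List.ofFn w)))) =
        (if w ∈ S then η.real (cyl (List.ofFn w)) * Real.log a else 0) +
        η.real (cyl (List.ofFn w)) * Real.log (ν.real (cyl (List.ofFn w))) -
        η.real (cyl (List.ofFn w)) * Real.log (η.real (cyl (List.ofFn w))) := by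
      intro w
      rw [Real.log_mul (by split_ifs <;> positivity) (hν _)]
      split_ifs
      · ring
      · rw [Real.log_one]; ring
    have e2 : ∑ w : Fin n → Fin N, (if w ∈ S then a else 1) * ν.real (cyl (List.ofFn w)) ≤ 2 := by
      calc _ ≤ ∑ w : Fin n → Fin N, ((if w ∈ S then a * ν.real (cyl (List.ofFn w)) else 0) +
            ν.real (cyl (List.ofFn w))) := by
            refine Finset.sum_le_sum fun w _ => ?_
            have : 0 ≤ ν.real (cyl (List.ofFn w)) := measureReal_nonneg
            split_ifs <;> linarith
        _ = a * ν.real (res n ⁻¹' S) + 1 := by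
            rw [Finset.sum_add_distrib, sum_real_cyl, real_preimage_res, Finset.mul_sum,
              Finset.sum_ite_mem, Finset.univ_inter]
        _ ≤ a * (1 / a) + 1 := by gcongr
        _ = 2 := by rw [mul_one_div_cancel ha.ne']; norm_num
    have e3 : 0 < ∑ w : Fin n → Fin N, (if w ∈ S then a else 1) * ν.real (cyl (List.ofFn w)) := by
      obtain ⟨w, -, -⟩ := Finset.exists_ne_zero_of_sum_ne_zero
        ((sum_real_cyl η n).trans_ne one_ne_zero)
      refine Finset.sum_pos (fun w _ => mul_pos (by split_ifs <;> positivity)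
        (lt_of_le_of_ne measureReal_nonneg (hν _).symm)) ⟨w, Finset.mem_univ w⟩
    rw [Finset.sum_congr rfl fun w _ => e1 w, Finset.sum_sub_distrib, Finset.sum_add_distrib,
      Finset.sum_ite_mem, Finset.univ_inter, ← Finset.sum_mul, ← real_preimage_res] at hg
    have hl := Real.log_le_log e3 e2
    have hn := h n
    rw [integral_pre η n fun w => Real.log (ν.real (cyl w))] at hn
    simp only [blockEntropy] at hn
    linarith
  refine absolutelyContinuous_of_res fun ε hε => ?_
  refine ⟨1 / Real.exp ((|D| + Real.log 2) / ε), by positivity, fun n S hS => ?_⟩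
  have h1 := key n S _ (Real.exp_pos _) hS
  rw [Real.log_exp] at h1
  have hl2 : 0 < Real.log 2 := Real.log_pos one_lt_two
  have h2 : η.real (res n ⁻¹' S) * ((|D| + Real.log 2) / ε) ≤ |D| + Real.log 2 :=
    h1.trans (by linarith [le_abs_self D])
  have hpos : 0 < |D| + Real.log 2 := by positivity
  rw [← mul_div_assoc, div_le_iff₀ hε] at h2
  have := (mul_le_mul_iff_of_pos_right hpos).1 (h2.trans_eq (mul_comm _ _))
  exact this

/-! ### Equilibrium states -/

/-- The normalization of `f` to zero pressure. -/
lemma AlmostAdditive.logPressure_normalize [Nonempty (Fin N)] {C : ℝ} {f : List (Fin N) → ℝ}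
    (hf : AlmostAdditive C f) :
    logPressure (fun w => f w + w.length * -logPressure f) = 0 := by
  rw [hf.logPressure_add_length]; ring

/-- The potential `e^f` of an almost-additive `f` has exactly one equilibrium state. It is the
invariant Gibbs measure `ν`: any other equilibrium state `η` has relative entropies with respect to
`ν` on the cylinder partitions that are bounded, since block entropies are at least `n h(η)`; so
`η ≪ ν`, and `ν` is ergodic. -/
theorem AlmostAdditive.existsUnique_equilibrium [Nonempty (Fin N)] {C : ℝ}
    {f : List (Fin N) → ℝ} (hf : AlmostAdditive C f) :
    ∃! ν : Measure (ℕ → Fin N), IsInvariant ν ∧ logPressure f = entropy ν + meanGrowth f ν := by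
  obtain ⟨ν, hν, hG⟩ := (hf.add_length (-logPressure f)).exists_invariant_gibbs
    hf.logPressure_normalize
  have hνp := hν.1
  have hpos : ∀ w, 0 < ν.real (cyl w) := fun w => (Real.exp_pos _).trans_le (hG w).1
  have hlog : ∀ w : List (Fin N),
      |Real.log (ν.real (cyl w)) - (f w + w.length * -logPressure f)| ≤ 5 * C := by
    intro w
    have h1 := Real.log_le_log (Real.exp_pos _) (hG w).1
    have h2 := Real.log_le_log (hpos w) (hG w).2
    rw [Real.log_exp] at h1 h2
    rw [abs_le]
    constructor <;> linarith
  -- the integral of `log ν[x|ₙ]` against an invariant measure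
  have hint : ∀ η : Measure (ℕ → Fin N), IsInvariant η → ∀ n : ℕ,
      |∫ x, Real.log (ν.real (cyl (pre x n))) ∂η - n * (meanGrowth f η - logPressure f)|
        ≤ 6 * C := by
    intro η hη n
    have := hη.1
    have h1 := abs_le.1 ((hf.meanGrowth_spec hη).1 n)
    have e : ∫ x, (f (pre x n) + n * -logPressure f) ∂η =
        ∫ x, f (pre x n) ∂η + n * -logPressure f := by
      rw [integral_add (integrable_pre η n f) (integrable_const _), integral_const]
      simp
    have h2 := norm_integral_le_of_norm_le_const (μ := η) (C := 5 * C)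
      (f := fun x => Real.log (ν.real (cyl (pre x n))) - (f (pre x n) + n * -logPressure f))
      (Eventually.of_forall fun x => by
        have := hlog (pre x n)
        simp only [pre, List.length_ofFn] at this ⊢
        exact this)
    rw [integral_sub (integrable_pre η n fun w => Real.log (ν.real (cyl w)))
      (g := fun x => f (pre x n) + n * -logPressure f)
      ((integrable_pre η n f).add (integrable_const _)), e, probReal_univ, mul_one,
      Real.norm_eq_abs, abs_le] at h2
    rw [abs_le]
    constructor <;> linarith
  refine ⟨ν, ⟨hν, le_antisymm ?_ (hf.entropy_add_meanGrowth_le hν)⟩, fun η ⟨hη, heq⟩ => ?_⟩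
  · have : logPressure f - meanGrowth f ν ≤ entropy ν := by
      refine le_entropy_of_forall_le hν (D := 6 * C) fun n => ?_
      have h1 := (abs_le.1 (hint ν hν n)).2
      have h2 := integral_pre ν n fun w => Real.log (ν.real (cyl w))
      simp only [blockEntropy]
      linarith
    linarith
  · have hηp := hη.1
    have herg : Ergodic shift ν := by
      refine hν.ergodic (c := Real.exp (-(16 * C))) (Real.exp_pos _) fun u v => ?_
      have h1 := (hG u).2
      have h2 := (hG v).2
      have h3 := (hG (u ++ v)).1
      have h4 := (abs_le.1 (hf.add_length (-logPressure f) u v)).1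
      calc _ ≤ Real.exp (-(16 * C)) * (Real.exp (f u + u.length * -logPressure f + 5 * C) *
            Real.exp (f v + v.length * -logPressure f + 5 * C)) := by gcongr
        _ ≤ _ := by
          refine le_trans ?_ h3
          rw [← Real.exp_add, ← Real.exp_add, Real.exp_le_exp]
          linarith
    refine herg.eq_of_absolutelyContinuous hη.2 ?_
    refine absolutelyContinuous_of_relEntropy_le (fun w => (hpos w).ne') (D := 6 * C) fun n => ?_
    have h1 := (abs_le.1 (hint η hη n)).1
    have h2 := hη.entropy_spec.1 n
    rw [heq] at h1
    linarith

lemma isInvariant_of_tendsto_cyl {ι : Type*} {l : Filter ι} [l.NeBot]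
    {ν : ι → Measure (ℕ → Fin N)} {η : Measure (ℕ → Fin N)} [IsProbabilityMeasure η]
    (hν : ∀ᶠ i in l, IsInvariant (ν i))
    (h : ∀ w, Tendsto (fun i => (ν i).real (cyl w)) l (𝓝 (η.real (cyl w)))) : IsInvariant η := by
  refine ⟨inferInstance, measurable_shift, ?_⟩
  have : IsProbabilityMeasure (η.map shift) :=
    Measure.isProbabilityMeasure_map measurable_shift.aemeasurable
  refine ext_of_cyl fun w => ?_
  rw [map_measureReal_apply measurable_shift (measurableSet_cyl w)]
  have h1 : Tendsto (fun i => ∑ u : Fin 1 → Fin N, (ν i).real (cyl (List.ofFn u ++ w))) l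
      (𝓝 (η.real (shift ⁻¹' cyl w))) := by
    have : η.real (shift ⁻¹' cyl w) = ∑ u : Fin 1 → Fin N, η.real (cyl (List.ofFn u ++ w)) :=
      (sum_real_cyl_append_left η 1 w).symm
    rw [this]
    exact tendsto_finsetSum _ fun u _ => h _
  refine tendsto_nhds_unique h1 ((h w).congr' ?_)
  filter_upwards [hν] with i hi
  exact (hi.sum_real_cyl_append_left 1 w).symm

/-- Mean growth is continuous along cylinder-wise limits of invariant measures, as the convergence
to it is uniform in the measure. -/
lemma AlmostAdditive.tendsto_meanGrowth {ι : Type*} {l : Filter ι} {C : ℝ}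
    {f : List (Fin N) → ℝ} (hf : AlmostAdditive C f)
    {ν : ι → Measure (ℕ → Fin N)} {η : Measure (ℕ → Fin N)} (hη : IsInvariant η)
    (hν : ∀ᶠ i in l, IsInvariant (ν i))
    (h : ∀ w, Tendsto (fun i => (ν i).real (cyl w)) l (𝓝 (η.real (cyl w)))) :
    Tendsto (fun i => meanGrowth f (ν i)) l (𝓝 (meanGrowth f η)) := by
  have := hη.1
  rw [Metric.tendsto_nhds]
  intro ε hε
  obtain ⟨n, hn⟩ := exists_nat_gt ((2 * C + 1) / ε)
  have hC := hf.const_nonneg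
  have hn0 : (0 : ℝ) < n := lt_of_le_of_lt (by positivity) hn
  rw [div_lt_iff₀ hε] at hn
  have ht : Tendsto (fun i => ∑ w : Fin n → Fin N, (ν i).real (cyl (List.ofFn w)) *
      f (List.ofFn w)) l (𝓝 (∫ x, f (pre x n) ∂η)) := by
    rw [integral_pre]
    exact tendsto_finsetSum _ fun w _ => (h _).mul_const _
  filter_upwards [hν, (Metric.tendsto_nhds.1 ht) 1 one_pos] with i hi hdist
  have := hi.1
  rw [← integral_pre, Real.dist_eq, abs_lt] at hdist
  have h1 := abs_le.1 ((hf.meanGrowth_spec hi).1 n)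
  have h2 := abs_le.1 ((hf.meanGrowth_spec hη).1 n)
  rw [Real.dist_eq, abs_lt]
  constructor <;> nlinarith

/-- The entropy is upper semicontinuous along cylinder-wise limits. -/
lemma le_entropy_of_tendsto {ι : Type*} {l : Filter ι} [l.NeBot]
    {ν : ι → Measure (ℕ → Fin N)} {η : Measure (ℕ → Fin N)} (hη : IsInvariant η)
    (hν : ∀ᶠ i in l, IsInvariant (ν i))
    (h : ∀ w, Tendsto (fun i => (ν i).real (cyl w)) l (𝓝 (η.real (cyl w)))) {H : ℝ}
    (hH : Tendsto (fun i => entropy (ν i)) l (𝓝 H)) : H ≤ entropy η := by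
  refine le_entropy_of_forall_le hη (D := 0) fun n => ?_
  rw [add_zero]
  have ht : Tendsto (fun i => blockEntropy (ν i) n) l (𝓝 (blockEntropy η n)) := by
    refine Tendsto.neg (tendsto_finsetSum _ fun w _ => ?_)
    exact (Real.continuous_mul_log.tendsto _).comp (h _)
  refine le_of_tendsto_of_tendsto (hH.const_mul (n : ℝ)) ht ?_
  filter_upwards [hν] with i hi
  exact hi.entropy_spec.1 n

/-! ### Quasi-geodesics in a Ptolemaic group -/

/-- A submultiplicative symmetric length function `ℓ ≥ 1` on a group that satisfies Ptolemy's
inequality for the four points `1, a, ab, abc`. The norm of `SL₂(ℝ)` is an example, where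
`2 log ℓ(g)` is the distance by which `g` moves a base point of the hyperbolic plane. -/
structure IsPtolemaic {G : Type*} [Group G] (ℓ : G → ℝ) : Prop where
  one_le : ∀ g, 1 ≤ ℓ g
  map_one : ℓ 1 = 1
  mul_le : ∀ g h, ℓ (g * h) ≤ ℓ g * ℓ h
  map_inv : ∀ g, ℓ g⁻¹ = ℓ g
  ptolemy : ∀ a b c, ℓ (a * b) * ℓ (b * c) ≤ ℓ (a * b * c) * ℓ b + ℓ a * ℓ c

/-- In the hyperbolic picture, `e^{-2 (x | y)}` for the Gromov product at the base point. -/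
noncomputable def gromovDist {G : Type*} [Group G] (ℓ : G → ℝ) (x y : G) : ℝ :=
  ℓ (x⁻¹ * y) / (ℓ x * ℓ y)

namespace IsPtolemaic

variable {G : Type*} [Group G] {ℓ : G → ℝ}

lemma pos (h : IsPtolemaic ℓ) (g : G) : 0 < ℓ g := zero_lt_one.trans_le (h.one_le g)

lemma gromovDist_comm (h : IsPtolemaic ℓ) (x y : G) : gromovDist ℓ x y = gromovDist ℓ y x := by
  rw [gromovDist, gromovDist, ← h.map_inv (x⁻¹ * y), mul_comm (ℓ x)]
  simp

/-- Ptolemy's inequality, divided by the lengths of the three points. -/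
lemma gromovDist_triangle (h : IsPtolemaic ℓ) (x y z : G) :
    gromovDist ℓ x z ≤ gromovDist ℓ x y + gromovDist ℓ y z := by
  have hx := h.pos x
  have hy := h.pos y
  have hz := h.pos z
  have hp := h.ptolemy x⁻¹ z (z⁻¹ * y)
  rw [mul_assoc x⁻¹, mul_inv_cancel_left, h.map_inv x, ← h.map_inv (z⁻¹ * y), mul_inv_rev,
    inv_inv] at hp
  have e : gromovDist ℓ x y + gromovDist ℓ y z - gromovDist ℓ x z =
      (ℓ (x⁻¹ * y) * ℓ z + ℓ x * ℓ (y⁻¹ * z) - ℓ (x⁻¹ * z) * ℓ y) / (ℓ x * ℓ y * ℓ z) := by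
    simp only [gromovDist]
    field_simp
  have : 0 ≤ gromovDist ℓ x y + gromovDist ℓ y z - gromovDist ℓ x z := by
    rw [e]
    exact div_nonneg (by linarith) (by positivity)
  linarith

lemma gromovDist_le_sum (h : IsPtolemaic ℓ) (x : ℕ → G) {m n : ℕ} (hmn : m < n) :
    gromovDist ℓ (x m) (x n) ≤ ∑ j ∈ Finset.Ico m n, gromovDist ℓ (x j) (x (j + 1)) := by
  induction n, hmn using Nat.le_induction with
  | base => simp
  | succ n hn ih =>
    rw [Finset.sum_Ico_succ_top (by omega)]
    exact (h.gromovDist_triangle _ (x n) _).trans (by linarith)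

/-- The constant in `exists_last_below`. What matters is that it grows only linearly with `M`. -/
noncomputable def tailConst (c r : ℝ) (p M : ℕ) : ℝ :=
  (r ^ p) ^ 2 * (p * M + (c ^ 2)⁻¹ * (1 - (r ^ 2)⁻¹)⁻¹)

/-- The first `p M` terms are bounded by the first entry of the minimum, the others by a geometric
series. -/
lemma sum_min_le {c r : ℝ} (hc : 0 < c) (hr : 1 < r) (p M n : ℕ) :
    ∑ i ∈ Finset.range n, min (((r ^ (p * M)) ^ 2)⁻¹) (((c * r ^ i) ^ 2)⁻¹) ≤
      (p * M + (c ^ 2)⁻¹ * (1 - (r ^ 2)⁻¹)⁻¹) / (r ^ (p * M)) ^ 2 := by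
  have hr0 : 0 < r := by linarith
  have hq : (r ^ 2)⁻¹ < 1 := inv_lt_one_of_one_lt₀ (one_lt_pow₀ hr two_ne_zero)
  have hq0 : 0 ≤ (r ^ 2)⁻¹ := by positivity
  calc ∑ i ∈ Finset.range n, min (((r ^ (p * M)) ^ 2)⁻¹) (((c * r ^ i) ^ 2)⁻¹)
      ≤ ∑ i ∈ Finset.range (p * M + n),
          min (((r ^ (p * M)) ^ 2)⁻¹) (((c * r ^ i) ^ 2)⁻¹) := by
        refine Finset.sum_le_sum_of_subset_of_nonneg ?_ fun i _ _ => by positivity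
        exact Finset.range_subset_range.2 (Nat.le_add_left _ _)
    _ = ∑ i ∈ Finset.range (p * M), min (((r ^ (p * M)) ^ 2)⁻¹) (((c * r ^ i) ^ 2)⁻¹) +
        ∑ k ∈ Finset.range n,
          min (((r ^ (p * M)) ^ 2)⁻¹) (((c * r ^ (p * M + k)) ^ 2)⁻¹) :=
        Finset.sum_range_add _ _ _
    _ ≤ ∑ i ∈ Finset.range (p * M), ((r ^ (p * M)) ^ 2)⁻¹ +
        ∑ k ∈ Finset.range n, (c ^ 2)⁻¹ * ((r ^ (p * M)) ^ 2)⁻¹ * ((r ^ 2)⁻¹) ^ k := by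
        gcongr with i _ k _
        · exact min_le_left _ _
        · refine (min_le_right _ _).trans_eq ?_
          rw [← mul_inv, inv_pow, ← mul_inv]
          congr 1
          ring
    _ ≤ (p * M) * ((r ^ (p * M)) ^ 2)⁻¹ +
        (c ^ 2)⁻¹ * ((r ^ (p * M)) ^ 2)⁻¹ * (1 - (r ^ 2)⁻¹)⁻¹ := by
        rw [← Finset.mul_sum]
        gcongr
        · simp
        · rw [← tsum_geometric_of_lt_one hq0 hq]
          exact (summable_geometric_of_lt_one hq0 hq).sum_le_tsum _ fun _ _ => by positivity
    _ = _ := by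
        rw [div_eq_mul_inv]
        ring

/-- Along a path of exponentially growing length, the last point with `ℓ ≤ r ^ (p M)` has,
up to `tailConst`, the largest possible Gromov product with the end point. -/
lemma exists_last_below (h : IsPtolemaic ℓ) {c r : ℝ} (hc : 0 < c) (hr : 1 < r) {p : ℕ}
    {x : ℕ → G} {n : ℕ} (h0 : x 0 = 1) (hstep : ∀ j < n, ℓ ((x j)⁻¹ * x (j + 1)) ≤ r ^ p)
    (hgrow : ∀ j ≤ n, c * r ^ j ≤ ℓ (x j)) (M : ℕ) :
    ℓ (x n) ≤ r ^ (p * M) ∨ ∃ m, M ≤ m ∧ m < n ∧ ℓ (x m) ≤ r ^ (p * M) ∧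
      gromovDist ℓ (x m) (x n) ≤ tailConst c r p M / (r ^ (p * M)) ^ 2 := by
  classical
  by_cases hn : ℓ (x n) ≤ r ^ (p * M)
  · exact Or.inl hn
  right
  have hr0 : 0 < r := by linarith
  -- a step multiplies the length by at most `r ^ p`, so the chosen point has index at least `M`
  have hup : ∀ j ≤ n, ℓ (x j) ≤ r ^ (p * j) := by
    intro j
    induction j with
    | zero => intro _; simp [h0, h.map_one]
    | succ j ih =>
      intro hj
      have e : x (j + 1) = x j * ((x j)⁻¹ * x (j + 1)) := by group
      rw [e]
      calc _ ≤ ℓ (x j) * ℓ ((x j)⁻¹ * x (j + 1)) := h.mul_le _ _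
        _ ≤ r ^ (p * j) * r ^ p := by
          have := h.pos ((x j)⁻¹ * x (j + 1))
          gcongr
          · exact ih (by omega)
          · exact hstep j (by omega)
        _ = _ := by rw [← pow_add, Nat.mul_succ]
  set P : ℕ → Prop := fun j => ℓ (x j) ≤ r ^ (p * M) with hP
  have hP0 : P 0 := by
    simp only [hP, h0, h.map_one]
    exact one_le_pow₀ hr.le
  have hPm : P (Nat.findGreatest P n) := Nat.findGreatest_spec (P := P) (Nat.zero_le n) hP0
  have hle : Nat.findGreatest P n ≤ n := Nat.findGreatest_le n
  refine ⟨Nat.findGreatest P n, ?_, lt_of_le_of_ne hle ?_, hPm, ?_⟩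
  · have hMn : M ≤ n := by
      by_contra! hlt
      exact hn ((hup n le_rfl).trans (pow_le_pow_right₀ hr.le (Nat.mul_le_mul_left p hlt.le)))
    exact Nat.le_findGreatest hMn (hup M hMn)
  · intro he
    rw [he] at hPm
    exact hn hPm
  · set m := Nat.findGreatest P n
    have hmn : m < n := lt_of_le_of_ne hle (fun he => hn (by rw [he] at hPm; exact hPm))
    have hterm : ∀ j ∈ Finset.Ico m n, gromovDist ℓ (x j) (x (j + 1)) ≤
        (r ^ p) ^ 2 * min (((r ^ (p * M)) ^ 2)⁻¹) (((c * r ^ (j + 1)) ^ 2)⁻¹) := by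
      intro j hj
      obtain ⟨hj1, hj2⟩ := Finset.mem_Ico.1 hj
      have hbig : r ^ (p * M) < ℓ (x (j + 1)) := by
        have := Nat.findGreatest_is_greatest (P := P) (n := n) (k := j + 1)
          (Nat.lt_succ_of_le hj1) (by omega)
        exact not_le.1 this
      have hs := hstep j hj2
      have hpj := h.pos (x j)
      have hpj1 := h.pos (x (j + 1))
      have hback : ℓ (x (j + 1)) ≤ ℓ (x j) * r ^ p := by
        have e : x (j + 1) = x j * ((x j)⁻¹ * x (j + 1)) := by group
        calc ℓ (x (j + 1)) = ℓ (x j * ((x j)⁻¹ * x (j + 1))) := by rw [← e]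
          _ ≤ ℓ (x j) * ℓ ((x j)⁻¹ * x (j + 1)) := h.mul_le _ _
          _ ≤ _ := by gcongr
      have h1 : gromovDist ℓ (x j) (x (j + 1)) ≤ (r ^ p) ^ 2 * (ℓ (x (j + 1)) ^ 2)⁻¹ := by
        rw [gromovDist, div_le_iff₀ (by positivity)]
        calc _ ≤ r ^ p := hs
          _ = r ^ p * (ℓ (x (j + 1)) * (ℓ (x (j + 1)))⁻¹) := by
            rw [mul_inv_cancel₀ hpj1.ne', mul_one]
          _ ≤ r ^ p * (ℓ (x j) * r ^ p * (ℓ (x (j + 1)))⁻¹) := by gcongr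
          _ = _ := by field_simp
      refine h1.trans ?_
      gcongr
      refine le_min ?_ ?_
      · gcongr
      · have := hgrow (j + 1) (by omega)
        gcongr
    calc gromovDist ℓ (x m) (x n)
        ≤ ∑ j ∈ Finset.Ico m n, gromovDist ℓ (x j) (x (j + 1)) := h.gromovDist_le_sum x hmn
      _ ≤ ∑ j ∈ Finset.Ico m n,
          (r ^ p) ^ 2 * min (((r ^ (p * M)) ^ 2)⁻¹) (((c * r ^ (j + 1)) ^ 2)⁻¹) :=
        Finset.sum_le_sum hterm
      _ = (r ^ p) ^ 2 * ∑ i ∈ Finset.Ico (m + 1) (n + 1),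
          min (((r ^ (p * M)) ^ 2)⁻¹) (((c * r ^ i) ^ 2)⁻¹) := by
        rw [← Finset.mul_sum, Finset.sum_Ico_add'
          (fun i => min (((r ^ (p * M)) ^ 2)⁻¹) (((c * r ^ i) ^ 2)⁻¹))]
      _ ≤ (r ^ p) ^ 2 * ∑ i ∈ Finset.range (n + 1),
          min (((r ^ (p * M)) ^ 2)⁻¹) (((c * r ^ i) ^ 2)⁻¹) := by
        gcongr
        intro i hi
        exact Finset.mem_range.2 (Finset.mem_Ico.1 hi).2
      _ ≤ (r ^ p) ^ 2 * ((p * M + (c ^ 2)⁻¹ * (1 - (r ^ 2)⁻¹)⁻¹) / (r ^ (p * M)) ^ 2) := by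
        gcongr
        exact sum_min_le hc hr p M _
      _ = _ := by rw [tailConst, mul_div_assoc]

lemma exists_tailConst_lt {c r : ℝ} (hc : 0 < c) (hr : 1 < r) (p : ℕ) :
    ∃ M : ℕ, 2 * tailConst c r p M + 1 ≤ c * r ^ (2 * M) := by
  have hr0 : 0 < r := by linarith
  have hq : (r ^ 2)⁻¹ < 1 := inv_lt_one_of_one_lt₀ (one_lt_pow₀ hr two_ne_zero)
  have hq0 : 0 ≤ (r ^ 2)⁻¹ := by positivity
  have h1 := tendsto_self_mul_const_pow_of_lt_one hq0 hq
  have h2 := tendsto_pow_atTop_nhds_zero_of_lt_one hq0 hq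
  have h3 := (h1.const_mul (2 * (r ^ p) ^ 2 * p)).add
    (h2.const_mul (2 * (r ^ p) ^ 2 * ((c ^ 2)⁻¹ * (1 - (r ^ 2)⁻¹)⁻¹) + 1))
  rw [mul_zero, mul_zero, add_zero] at h3
  obtain ⟨M, hM⟩ := ((tendsto_order.1 h3).2 c hc).exists
  refine ⟨M, ?_⟩
  have hpos : 0 < r ^ (2 * M) := by positivity
  have e : ((r ^ 2)⁻¹) ^ M = (r ^ (2 * M))⁻¹ := by rw [inv_pow, pow_mul]
  have h4 : (2 * tailConst c r p M + 1) * (r ^ (2 * M))⁻¹ < c := by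
    rw [e] at hM
    refine lt_of_eq_of_lt ?_ hM
    rw [tailConst]
    ring
  rw [← div_eq_mul_inv, div_lt_iff₀ hpos] at h4
  exact h4.le

/-- Stability of quasi-geodesics, in multiplicative form: if the length of the products along all
words grows exponentially, then the length is almost multiplicative.

On the path from `1` through the prefixes of `v`, and on the one through the inverses of the
suffixes of `u`, take the last points `x`, `y` with `ℓ ≤ L = r ^ (p M)`. Both have index at
least `M`, so `gromovDist y x ≥ c r ^ (2 M) / L ^ 2`, whereas replacing `x`, `y` by the end points
changes `gromovDist` by at most `2 * tailConst / L ^ 2`, with `tailConst` linear in `M`. -/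
theorem exists_mul_le (h : IsPtolemaic ℓ) (A : Fin N → G) {c r : ℝ} (hc : 0 < c)
    (hr : 1 < r) (hgrow : ∀ w : List (Fin N), c * r ^ w.length ≤ ℓ (w.map A).prod) :
    ∃ D : ℝ, 1 ≤ D ∧ ∀ u v : List (Fin N),
      ℓ (u.map A).prod * ℓ (v.map A).prod ≤ D * ℓ ((u ++ v).map A).prod := by
  have hr0 : 0 < r := by linarith
  obtain ⟨p, hp⟩ : ∃ p : ℕ, ∀ i, ℓ (A i) ≤ r ^ p := by
    obtain ⟨p, hp⟩ := pow_unbounded_of_one_lt (∑ i, ℓ (A i)) hr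
    exact ⟨p, fun i => (Finset.single_le_sum (f := fun i => ℓ (A i))
      (fun i _ => (h.pos _).le) (Finset.mem_univ i)).trans hp.le⟩
  obtain ⟨M, hM⟩ := exists_tailConst_lt hc hr p
  set L := r ^ (p * M) with hL
  have hL0 : 0 < L := by positivity
  have hL1 : 1 ≤ L := one_le_pow₀ hr.le
  refine ⟨L ^ 2, one_le_pow₀ hL1, fun u v => ?_⟩
  set W : List (Fin N) → G := fun w => (w.map A).prod with hW
  have hWapp : ∀ u v, W (u ++ v) = W u * W v := fun u v => by simp [hW]
  change ℓ (W u) * ℓ (W v) ≤ L ^ 2 * ℓ (W (u ++ v))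
  have pu := h.pos (W u)
  have pv := h.pos (W v)
  have puv := h.pos (W (u ++ v))
  have hx := h.exists_last_below hc hr (p := p) (x := fun j => W (v.take j)) (n := v.length)
    (by simp [hW])
    (fun j hj => by
      rw [List.take_succ_eq_append_getElem hj, hWapp]
      simpa [hW] using hp _)
    (fun j hj => by
      have := hgrow (v.take j)
      rwa [List.length_take_of_le hj] at this) M
  have hy := h.exists_last_below hc hr (p := p) (x := fun k => (W (u.drop (u.length - k)))⁻¹)
    (n := u.length) (by simp [hW])
    (fun k hk => by
      have e : u.drop (u.length - (k + 1)) =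
          u[u.length - (k + 1)]'(by omega) :: u.drop (u.length - k) := by
        rw [List.drop_eq_getElem_cons (by omega)]
        congr 2
        omega
      have e2 : W (u.drop (u.length - (k + 1))) =
          A (u[u.length - (k + 1)]'(by omega)) * W (u.drop (u.length - k)) := by
        rw [e]
        simp [hW]
      rw [e2, mul_inv_rev, inv_inv, mul_inv_cancel_left, h.map_inv]
      exact hp _)
    (fun k hk => by
      have := hgrow (u.drop (u.length - k))
      rw [List.length_drop, show u.length - (u.length - k) = k by omega] at this
      rwa [h.map_inv]) M
  simp only [List.take_length, Nat.sub_self, List.drop_zero, h.map_inv] at hx hy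
  -- a factor with `ℓ ≤ L` costs at most a factor `L ^ 2`
  rcases hx with hx | ⟨m, hMm, hmn, hmL, hmd⟩
  · have h1 : ℓ (W u) ≤ ℓ (W (u ++ v)) * ℓ (W v) := by
      have := h.mul_le (W (u ++ v)) (W v)⁻¹
      rwa [hWapp, mul_inv_cancel_right, h.map_inv, ← hWapp] at this
    calc ℓ (W u) * ℓ (W v) ≤ ℓ (W (u ++ v)) * ℓ (W v) * ℓ (W v) := by gcongr
      _ ≤ ℓ (W (u ++ v)) * L * L := by gcongr
      _ = _ := by ring
  rcases hy with hy | ⟨k, hMk, hkn, hkL, hkd⟩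
  · have h1 : ℓ (W v) ≤ ℓ (W u) * ℓ (W (u ++ v)) := by
      have := h.mul_le (W u)⁻¹ (W (u ++ v))
      rwa [hWapp, inv_mul_cancel_left, h.map_inv, ← hWapp] at this
    calc ℓ (W u) * ℓ (W v) ≤ ℓ (W u) * (ℓ (W u) * ℓ (W (u ++ v))) := by gcongr
      _ ≤ L * (L * ℓ (W (u ++ v))) := by gcongr
      _ = _ := by ring
  · set y := (W (u.drop (u.length - k)))⁻¹ with hy
    set x := W (v.take m) with hx
    have hlow : c * r ^ (2 * M) / L ^ 2 ≤ gromovDist ℓ y x := by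
      have e : y⁻¹ * x = W (u.drop (u.length - k) ++ v.take m) := by
        rw [hWapp, hy, inv_inv]
      have hg := hgrow (u.drop (u.length - k) ++ v.take m)
      rw [List.length_append, List.length_drop, List.length_take_of_le hmn.le,
        show u.length - (u.length - k) = k by omega] at hg
      have py := h.pos y
      have px := h.pos x
      have hyL : ℓ y ≤ L := by rw [hy, h.map_inv]; exact hkL
      rw [gromovDist, e]
      have h1 : c * r ^ (2 * M) ≤ ℓ (W (u.drop (u.length - k) ++ v.take m)) := by
        refine le_trans ?_ hg
        gcongr
        · exact hr.le
        · omega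
      have h2 : ℓ y * ℓ x ≤ L ^ 2 := by rw [pow_two]; gcongr
      exact div_le_div₀ (h.pos _).le h1 (by positivity) h2
    have t1 := h.gromovDist_triangle y (W u)⁻¹ x
    have t2 := h.gromovDist_triangle (W u)⁻¹ (W v) x
    rw [h.gromovDist_comm (W v) x] at t2
    have hfin : 1 / L ^ 2 ≤ gromovDist ℓ (W u)⁻¹ (W v) := by
      have h1 : 1 / L ^ 2 ≤ c * r ^ (2 * M) / L ^ 2 - 2 * (tailConst c r p M / L ^ 2) := by
        rw [← mul_div_assoc, ← sub_div]
        gcongr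
        linarith
      linarith
    rw [gromovDist, inv_inv, h.map_inv, ← hWapp, div_le_div_iff₀ (by positivity) (by positivity)]
      at hfin
    linarith

end IsPtolemaic

/-! ### Operator norms of real `2 × 2` matrices -/

section OpNorm

open scoped Matrix.Norms.L2Operator

lemma opNorm_eq_norm (M : Matrix (Fin 2) (Fin 2) ℝ) : opNorm M = ‖M‖ := rfl

lemma opNorm_mul_le (M K : Matrix (Fin 2) (Fin 2) ℝ) : opNorm (M * K) ≤ opNorm M * opNorm K :=
  Matrix.l2_opNorm_mul M K

lemma opNorm_nonneg (M : Matrix (Fin 2) (Fin 2) ℝ) : 0 ≤ opNorm M := norm_nonneg _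

lemma opNorm_one : opNorm 1 = 1 := by
  rw [opNorm, map_one]
  exact norm_one

lemma adjugate_eq_rotation_conj (M : Matrix (Fin 2) (Fin 2) ℝ) :
    M.adjugate = !![0, 1; -1, 0] * M.conjTranspose * !![0, -1; 1, 0] := by
  rw [Matrix.adjugate_fin_two]
  ext i j
  fin_cases i <;> fin_cases j <;> simp [Matrix.mul_apply, Fin.sum_univ_two,
    Matrix.vecMul, Matrix.vecHead, Matrix.vecTail]

lemma opNorm_rotation_le : opNorm !![0, 1; -1, 0] ≤ 1 ∧ opNorm !![0, -1; 1, 0] ≤ 1 := by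
  have key : ∀ M : Matrix (Fin 2) (Fin 2) ℝ, M.conjTranspose * M = 1 → opNorm M ≤ 1 := by
    intro M hM
    have h := Matrix.l2_opNorm_conjTranspose_mul_self M
    rw [hM, ← opNorm_eq_norm, ← opNorm_eq_norm, opNorm_one] at h
    nlinarith [opNorm_nonneg M]
  constructor <;>
  · apply key
    ext i j
    fin_cases i <;> fin_cases j <;> simp [Matrix.mul_apply, Fin.sum_univ_two]

lemma opNorm_adjugate (M : Matrix (Fin 2) (Fin 2) ℝ) : opNorm M.adjugate = opNorm M := by
  have key : ∀ M : Matrix (Fin 2) (Fin 2) ℝ, opNorm M.adjugate ≤ opNorm M := by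
    intro M
    rw [adjugate_eq_rotation_conj]
    have h1 := opNorm_mul_le (!![0, 1; -1, 0] * M.conjTranspose) !![0, -1; 1, 0]
    have h2 := opNorm_mul_le !![0, 1; -1, 0] M.conjTranspose
    have h3 : opNorm M.conjTranspose = opNorm M := Matrix.l2_opNorm_conjTranspose M
    obtain ⟨h4, h5⟩ := opNorm_rotation_le
    have h6 := opNorm_nonneg M
    rw [h3] at h2
    have h7 := mul_le_of_le_one_left h6 h4
    exact h1.trans ((mul_le_of_le_one_right (opNorm_nonneg _) h5).trans (h2.trans h7))
  refine le_antisymm (key M) ?_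
  have := key M.adjugate
  rwa [Matrix.adjugate_adjugate M (by simp), Fintype.card_fin, pow_zero, one_smul] at this

lemma opNorm_inv (M : Matrix (Fin 2) (Fin 2) ℝ) : opNorm M⁻¹ = opNorm M / |M.det| := by
  rw [Matrix.inv_def, opNorm_eq_norm, norm_smul, ← opNorm_eq_norm, opNorm_adjugate,
    Ring.inverse_eq_inv', norm_inv, Real.norm_eq_abs]
  ring

lemma norm_mul_norm_le_of_forall {E F : Type*} [NormedAddCommGroup E] [NormedSpace ℝ E]
    [NormedAddCommGroup F] [NormedSpace ℝ F] {S T : E →L[ℝ] F} {R : ℝ} (hR : 0 ≤ R)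
    (h : ∀ y v, ‖S y‖ * ‖T v‖ ≤ R * (‖y‖ * ‖v‖)) : ‖S‖ * ‖T‖ ≤ R := by
  have h1 : ∀ v, ‖S‖ * ‖T v‖ ≤ R * ‖v‖ := by
    intro v
    have : ‖‖T v‖ • S‖ ≤ R * ‖v‖ :=
      ContinuousLinearMap.opNorm_le_bound _ (by positivity) fun y => by
        rw [smul_apply, norm_smul, norm_norm]
        linarith [h y v]
    rw [norm_smul, norm_norm] at this
    linarith
  have : ‖‖S‖ • T‖ ≤ R := ContinuousLinearMap.opNorm_le_bound _ hR fun v => by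
    rw [smul_apply, norm_smul, norm_norm]
    exact h1 v
  rwa [norm_smul, norm_norm] at this

/-- The minor identity `(uᵀBq)(pᵀBv) = (pᵀBq)(uᵀBv) + (u ∧ p) (q ∧ v) det B`, in terms of
Euclidean inner products. -/
lemma inner_mul_inner_eq (B : Matrix (Fin 2) (Fin 2) ℝ) (u p q v : EuclideanSpace ℝ (Fin 2)) :
    inner ℝ u (Matrix.toEuclideanCLM (𝕜 := ℝ) B q) *
        inner ℝ p (Matrix.toEuclideanCLM (𝕜 := ℝ) B v) =
      inner ℝ p (Matrix.toEuclideanCLM (𝕜 := ℝ) B q) *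
        inner ℝ u (Matrix.toEuclideanCLM (𝕜 := ℝ) B v) +
        (u 0 * p 1 - u 1 * p 0) * (q 0 * v 1 - q 1 * v 0) * B.det := by
  simp only [Matrix.inner_toEuclideanCLM, dotProduct, Matrix.mulVec, Fin.sum_univ_two,
    Matrix.det_fin_two]
  ring

lemma abs_cross_le (u p : EuclideanSpace ℝ (Fin 2)) : |u 0 * p 1 - u 1 * p 0| ≤ ‖u‖ * ‖p‖ := by
  refine abs_le_of_sq_le_sq ?_ (by positivity)
  rw [mul_pow, EuclideanSpace.norm_sq_eq, EuclideanSpace.norm_sq_eq]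
  simp only [Fin.sum_univ_two, Real.norm_eq_abs, sq_abs]
  nlinarith [sq_nonneg (u 0 * p 0 + u 1 * p 1)]

lemma mul_le_of_sq_mul_sq_le {a b R d : ℝ} (ha : 0 ≤ a) (hb : 0 ≤ b) (hR : 0 ≤ R * d)
    (h : a ^ 2 * b ^ 2 ≤ R * (a * b * d)) : a * b ≤ R * d := by
  rcases (mul_nonneg ha hb).eq_or_lt with h0 | h0
  · rwa [← h0]
  · refine le_of_mul_le_mul_left ?_ h0
    linarith

/-- Ptolemy's inequality for operator norms; it follows from the minor identity for
`pᵀ = xᵀA`, `q = Cy`. -/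
lemma opNorm_ptolemy (A B C : Matrix (Fin 2) (Fin 2) ℝ) :
    opNorm (B * C) * opNorm (A * B) ≤
      opNorm (A * B * C) * opNorm B + |B.det| * (opNorm A * opNorm C) := by
  have hA := opNorm_nonneg A
  have hB := opNorm_nonneg B
  have hC := opNorm_nonneg C
  have hABC := opNorm_nonneg (A * B * C)
  set T : Matrix (Fin 2) (Fin 2) ℝ → EuclideanSpace ℝ (Fin 2) →L[ℝ] EuclideanSpace ℝ (Fin 2) :=
    fun M => Matrix.toEuclideanCLM (𝕜 := ℝ) M with hT
  have hTm : ∀ (M K : Matrix (Fin 2) (Fin 2) ℝ) (z), T (M * K) z = T M (T K z) := fun M K z => by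
    simp [hT]
  have hTn : ∀ (M : Matrix (Fin 2) (Fin 2) ℝ) (z), ‖T M z‖ ≤ opNorm M * ‖z‖ := fun M z =>
    (T M).le_opNorm z
  set R := opNorm (A * B * C) * opNorm B + |B.det| * (opNorm A * opNorm C)
  have hR : 0 ≤ R := by positivity
  refine norm_mul_norm_le_of_forall (S := T (B * C)) (T := T (A * B)) hR fun y v => ?_
  -- for all test vectors `u`, `x`
  have key : ∀ u x : EuclideanSpace ℝ (Fin 2), inner ℝ u (T (B * C) y) * inner ℝ x (T (A * B) v) ≤
      R * (‖u‖ * ‖x‖ * (‖y‖ * ‖v‖)) := by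
    intro u x
    set p := ContinuousLinearMap.adjoint (T A) x with hp
    have hpn : ‖p‖ ≤ opNorm A * ‖x‖ := by
      have := (ContinuousLinearMap.adjoint (T A)).le_opNorm x
      rwa [LinearIsometryEquiv.norm_map] at this
    have hqn := hTn C y
    have hpi : ∀ z, inner ℝ p z = inner ℝ x (T A z) := fun z =>
      ContinuousLinearMap.adjoint_inner_left _ _ _
    have hid := inner_mul_inner_eq B u p (T C y) v
    change inner ℝ u (T B (T C y)) * inner ℝ p (T B v) = inner ℝ p (T B (T C y)) *
      inner ℝ u (T B v) + _ at hid
    rw [hpi, hpi, ← hTm, ← hTm, ← hTm, ← mul_assoc] at hid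
    rw [hid]
    have b1 : inner ℝ x (T (A * B * C) y) * inner ℝ u (T B v) ≤
        (‖x‖ * (opNorm (A * B * C) * ‖y‖)) * (‖u‖ * (opNorm B * ‖v‖)) := by
      refine (le_abs_self _).trans ?_
      rw [abs_mul]
      have i1 := (abs_real_inner_le_norm x (T (A * B * C) y)).trans
        (mul_le_mul_of_nonneg_left (hTn _ y) (norm_nonneg x))
      have i2 := (abs_real_inner_le_norm u (T B v)).trans
        (mul_le_mul_of_nonneg_left (hTn _ v) (norm_nonneg u))
      gcongr
    have b2 : (u 0 * p 1 - u 1 * p 0) * ((T C y) 0 * v 1 - (T C y) 1 * v 0) * B.det ≤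
        ‖u‖ * (opNorm A * ‖x‖) * (opNorm C * ‖y‖ * ‖v‖) * |B.det| := by
      refine (le_abs_self _).trans ?_
      rw [abs_mul, abs_mul]
      have i1 := (abs_cross_le u p).trans (mul_le_mul_of_nonneg_left hpn (norm_nonneg u))
      have i2 := (abs_cross_le (T C y) v).trans (mul_le_mul_of_nonneg_right hqn (norm_nonneg v))
      gcongr
    calc _ ≤ _ := add_le_add b1 b2
      _ = _ := by simp only [R]; ring
  have h1 := key (T (B * C) y) (T (A * B) v)
  rw [real_inner_self_eq_norm_sq, real_inner_self_eq_norm_sq] at h1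
  exact mul_le_of_sq_mul_sq_le (norm_nonneg _) (norm_nonneg _) (by positivity) h1

end OpNorm

/-- The operator norm of the matrix after scaling to determinant `±1`. -/
noncomputable def scaledNorm (g : GL (Fin 2) ℝ) : ℝ := opNorm g.val / Real.sqrt |g.val.det|

lemma det_ne_zero (g : GL (Fin 2) ℝ) : g.val.det ≠ 0 := g.isUnit.map Matrix.detMonoidHom |>.ne_zero

lemma opNorm_pos (g : GL (Fin 2) ℝ) : 0 < opNorm g.val := by
  have h := opNorm_mul_le g.val (g⁻¹).val
  rw [← Units.val_mul, mul_inv_cancel, Units.val_one, opNorm_one] at h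
  refine lt_of_le_of_ne (opNorm_nonneg _) fun h0 => ?_
  rw [← h0, zero_mul] at h
  linarith

lemma scaledNorm_pos (g : GL (Fin 2) ℝ) : 0 < scaledNorm g :=
  div_pos (opNorm_pos g) (Real.sqrt_pos.2 (abs_pos.2 (det_ne_zero g)))

lemma opNorm_inv_val (g : GL (Fin 2) ℝ) : opNorm (g⁻¹).val = opNorm g.val / |g.val.det| := by
  rw [Matrix.coe_units_inv, opNorm_inv]

lemma scaledNorm_inv (g : GL (Fin 2) ℝ) : scaledNorm g⁻¹ = scaledNorm g := by
  have hd : 0 < |g.val.det| := abs_pos.2 (det_ne_zero g)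
  have hs := Real.sqrt_pos.2 hd
  rw [scaledNorm, scaledNorm, opNorm_inv_val, Matrix.coe_units_inv, Matrix.det_nonsing_inv,
    Ring.inverse_eq_inv', abs_inv, Real.sqrt_inv]
  nth_rewrite 1 [← Real.mul_self_sqrt hd.le]
  field_simp

lemma scaledNorm_mul_le (g h : GL (Fin 2) ℝ) :
    scaledNorm (g * h) ≤ scaledNorm g * scaledNorm h := by
  rw [scaledNorm, scaledNorm, scaledNorm, Units.val_mul, Matrix.det_mul, abs_mul,
    Real.sqrt_mul (abs_nonneg _), div_mul_div_comm]
  gcongr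
  exact opNorm_mul_le _ _

lemma scaledNorm_one : scaledNorm 1 = 1 := by
  rw [scaledNorm, Units.val_one, opNorm_one, Matrix.det_one, abs_one, Real.sqrt_one, div_one]

/-- `scaledNorm` is `e^{d/2}` for the displacement `d` of a base point of the hyperbolic plane, for
which Ptolemy's inequality expresses hyperbolicity. -/
lemma isPtolemaic_scaledNorm : IsPtolemaic scaledNorm where
  one_le g := by
    have h := scaledNorm_mul_le g g⁻¹
    rw [mul_inv_cancel, scaledNorm_one, scaledNorm_inv] at h
    nlinarith [scaledNorm_pos g]
  map_one := scaledNorm_one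
  mul_le := scaledNorm_mul_le
  map_inv := scaledNorm_inv
  ptolemy a b c := by
    have h := opNorm_ptolemy a.val b.val c.val
    have ha := Real.sqrt_pos.2 (abs_pos.2 (det_ne_zero a))
    have hb := Real.sqrt_pos.2 (abs_pos.2 (det_ne_zero b))
    have hc := Real.sqrt_pos.2 (abs_pos.2 (det_ne_zero c))
    rw [← Real.mul_self_sqrt (abs_nonneg b.val.det)] at h
    simp only [scaledNorm, Units.val_mul, Matrix.det_mul, abs_mul, Real.sqrt_mul,
      mul_nonneg, abs_nonneg]
    set sa := Real.sqrt |a.val.det|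
    set sb := Real.sqrt |b.val.det|
    set sc := Real.sqrt |c.val.det|
    have e1 : opNorm (a.val * b.val) / (sa * sb) * (opNorm (b.val * c.val) / (sb * sc)) =
        (opNorm (b.val * c.val) * opNorm (a.val * b.val)) / (sa * (sb * sb) * sc) := by
      field_simp
    have e2 : opNorm (a.val * b.val * c.val) / (sa * sb * sc) * (opNorm b.val / sb) +
        opNorm a.val / sa * (opNorm c.val / sc) =
        (opNorm (a.val * b.val * c.val) * opNorm b.val +
          sb * sb * (opNorm a.val * opNorm c.val)) / (sa * (sb * sb) * sc) := by
      field_simp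
    rw [e1, e2]
    gcongr

/-! ### Singular values along words -/

section Words

variable (A : Fin N → GL (Fin 2) ℝ)

lemma wordProd_append (u v : List (Fin N)) : wordProd A (u ++ v) = wordProd A u * wordProd A v := by
  simp [wordProd]

/-- The logarithm of `|det A_w|`. -/
noncomputable def logDet (w : List (Fin N)) : ℝ := Real.log |(wordProd A w).val.det|

lemma logDet_append (u v : List (Fin N)) : logDet A (u ++ v) = logDet A u + logDet A v := by
  rw [logDet, logDet, logDet, wordProd_append, Units.val_mul, Matrix.det_mul, abs_mul,
    Real.log_mul (abs_pos.2 (det_ne_zero _)).ne' (abs_pos.2 (det_ne_zero _)).ne']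

lemma alpha1_pos (w : List (Fin N)) : 0 < alpha1 A w := opNorm_pos _

lemma alpha2_pos (w : List (Fin N)) : 0 < alpha2 A w := inv_pos.2 (opNorm_pos _)

lemma alpha2_eq (w : List (Fin N)) : alpha2 A w = |(wordProd A w).val.det| / alpha1 A w := by
  rw [alpha2, opNorm_inv_val, inv_div, alpha1]

lemma log_alpha2 (w : List (Fin N)) :
    Real.log (alpha2 A w) = logDet A w - Real.log (alpha1 A w) := by
  rw [alpha2_eq, Real.log_div (abs_pos.2 (det_ne_zero _)).ne' (alpha1_pos A w).ne', logDet]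

lemma log_alpha1 (w : List (Fin N)) :
    Real.log (alpha1 A w) = Real.log (scaledNorm (wordProd A w)) + logDet A w / 2 := by
  have hd := abs_pos.2 (det_ne_zero (wordProd A w))
  rw [scaledNorm, Real.log_div (opNorm_pos _).ne' (Real.sqrt_pos.2 hd).ne',
    Real.log_sqrt hd.le, logDet, alpha1]
  ring

lemma alpha2_le_alpha1 (w : List (Fin N)) : alpha2 A w ≤ alpha1 A w := by
  have h := opNorm_mul_le (wordProd A w).val (wordProd A w)⁻¹.val
  rw [← Units.val_mul, mul_inv_cancel, Units.val_one, opNorm_one] at h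
  rw [alpha2, inv_le_iff_one_le_mul₀ (opNorm_pos _)]
  exact h

variable {A}

/-- Domination makes the paths `A_{w|ₙ}` quasi-geodesic, as `scaledNorm ^ 2 = α₁ / α₂`, so the norm
is almost multiplicative. -/
lemma IsDominated.exists_almostAdditive (hdom : IsDominated A) :
    ∃ C, AlmostAdditive C fun w => Real.log (alpha1 A w) := by
  obtain ⟨C, t, hC, ht, ht1, h⟩ := hdom
  have hgrow : ∀ w : List (Fin N), Real.sqrt C⁻¹ * Real.sqrt t⁻¹ ^ w.length ≤
      scaledNorm (w.map A).prod := by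
    intro w
    change _ ≤ scaledNorm (wordProd A w)
    have hd := abs_pos.2 (det_ne_zero (wordProd A w))
    have h1 := alpha1_pos A w
    refine (sq_le_sq₀ (by positivity) (scaledNorm_pos _).le).1 ?_
    rw [mul_pow, ← pow_mul, mul_comm w.length, pow_mul, Real.sq_sqrt (by positivity),
      Real.sq_sqrt (by positivity), scaledNorm, div_pow, Real.sq_sqrt hd.le, inv_pow, ← mul_inv,
      inv_le_iff_one_le_mul₀ (by positivity)]
    have h2 := h w
    rw [alpha2_eq, div_le_iff₀ h1] at h2
    rw [div_mul_eq_mul_div, le_div_iff₀ hd, one_mul]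
    calc _ ≤ _ := h2
      _ = _ := by rw [alpha1]; ring
  obtain ⟨D, hD1, hD⟩ := isPtolemaic_scaledNorm.exists_mul_le A (Real.sqrt_pos.2 (inv_pos.2 hC))
    (by
      rw [Real.lt_sqrt zero_le_one, one_pow]
      exact (one_lt_inv₀ ht).2 ht1) hgrow
  refine ⟨Real.log D, fun u v => ?_⟩
  have h1 : Real.log (scaledNorm (wordProd A (u ++ v))) ≤
      Real.log (scaledNorm (wordProd A u)) + Real.log (scaledNorm (wordProd A v)) := by
    rw [← Real.log_mul (scaledNorm_pos _).ne' (scaledNorm_pos _).ne', wordProd_append]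
    exact Real.log_le_log (scaledNorm_pos _) (scaledNorm_mul_le _ _)
  have h2 : Real.log (scaledNorm (wordProd A u)) + Real.log (scaledNorm (wordProd A v)) ≤
      Real.log D + Real.log (scaledNorm (wordProd A (u ++ v))) := by
    rw [← Real.log_mul (scaledNorm_pos _).ne' (scaledNorm_pos _).ne',
      ← Real.log_mul (by linarith) (scaledNorm_pos _).ne']
    exact Real.log_le_log (mul_pos (scaledNorm_pos _) (scaledNorm_pos _)) (hD u v)
  have h3 := Real.log_nonneg hD1
  simp only [log_alpha1, logDet_append]
  rw [abs_le]
  constructor <;> linarith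

lemma IsDominated.exists_almostAdditive_alpha2 (hdom : IsDominated A) :
    ∃ C, AlmostAdditive C fun w => Real.log (alpha2 A w) := by
  obtain ⟨C, hC⟩ := hdom.exists_almostAdditive
  refine ⟨C, fun u v => ?_⟩
  have := abs_le.1 (hC u v)
  simp only [log_alpha2, logDet_append]
  rw [abs_le]
  constructor <;> linarith

lemma IsContractive.exists_alpha1_le (h : IsContractive A) :
    ∃ k < 0, ∀ w : List (Fin N), Real.log (alpha1 A w) ≤ w.length * k := by
  obtain ⟨ρ, hρ0, hρ1, hρ⟩ : ∃ ρ : ℝ, 0 < ρ ∧ ρ < 1 ∧ ∀ i, opNorm (A i).val ≤ ρ := by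
    rcases isEmpty_or_nonempty (Fin N) with he | hne
    · exact ⟨1 / 2, by norm_num, by norm_num, fun i => he.elim i⟩
    · obtain ⟨i, hi⟩ := Finite.exists_max fun i => opNorm (A i).val
      exact ⟨_, opNorm_pos _, h i, hi⟩
  refine ⟨Real.log ρ, Real.log_neg hρ0 hρ1, fun w => ?_⟩
  have hw : alpha1 A w ≤ ρ ^ w.length := by
    induction w with
    | nil => simp [alpha1, wordProd, opNorm_one]
    | cons i w ih =>
      have e : wordProd A (i :: w) = A i * wordProd A w := by simp [wordProd]
      rw [alpha1, e, Units.val_mul, List.length_cons, pow_succ']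
      exact (opNorm_mul_le _ _).trans
        (mul_le_mul (hρ i) ih (opNorm_nonneg _) hρ0.le)
  rw [← Real.log_pow]
  exact Real.log_le_log (alpha1_pos A w) hw

end Words

/-! ### Differentiability of the zero set of the pressure -/

section Implicit

variable {A B C : ℝ} {a b c : List (Fin N) → ℝ}

lemma AlmostAdditive.meanGrowth_affine (ha : AlmostAdditive A a) (hb : AlmostAdditive B b)
    (hc : AlmostAdditive C c) {ν : Measure (ℕ → Fin N)} (hν : IsInvariant ν) (x y : ℝ) :
    meanGrowth (fun w => a w + (x * c w + y * b w)) ν =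
      meanGrowth a ν + (x * meanGrowth c ν + y * meanGrowth b ν) := by
  have h := ha.meanGrowth_const_mul_add ((hc.const_mul x).add (hb.const_mul y)) hν 1 1
  simp only [one_mul] at h
  rw [h, hc.meanGrowth_const_mul_add hb hν]

lemma AlmostAdditive.affine (ha : AlmostAdditive A a) (hb : AlmostAdditive B b)
    (hc : AlmostAdditive C c) (x y : ℝ) :
    AlmostAdditive (A + (|x| * C + |y| * B)) fun w => a w + (x * c w + y * b w) :=
  ha.add ((hc.const_mul x).add (hb.const_mul y))

/-- The pressure is Lipschitz in the coefficients of a linear family of potentials. -/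
lemma AlmostAdditive.continuous_logPressure [Nonempty (Fin N)] (ha : AlmostAdditive A a)
    (hb : AlmostAdditive B b) (hc : AlmostAdditive C c) :
    Continuous fun z : ℝ × ℝ => logPressure fun w => a w + (z.1 * c w + z.2 * b w) := by
  obtain ⟨K₁, hK₁, h₁⟩ := hc.exists_linear_bound
  obtain ⟨K₂, hK₂, h₂⟩ := hb.exists_linear_bound
  refine (LipschitzWith.of_le_add_mul' (K₁ + K₂) fun z z' => ?_).continuous
  refine (ha.affine hb hc z.1 z.2).logPressure_le (ha.affine hb hc z'.1 z'.2)
    (B := |z.1 - z'.1| * C + |z.2 - z'.2| * B) fun w => ?_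
  have d₁ : |z.1 - z'.1| ≤ dist z z' := by rw [← Real.dist_eq]; exact le_max_left _ _
  have d₂ : |z.2 - z'.2| ≤ dist z z' := by rw [← Real.dist_eq]; exact le_max_right _ _
  have e₁ : (z.1 - z'.1) * c w ≤ |z.1 - z'.1| * (w.length * K₁ + C) :=
    (le_abs_self _).trans (by rw [abs_mul]; gcongr; exact h₁ w)
  have e₂ : (z.2 - z'.2) * b w ≤ |z.2 - z'.2| * (w.length * K₂ + B) :=
    (le_abs_self _).trans (by rw [abs_mul]; gcongr; exact h₂ w)
  have f₁ : |z.1 - z'.1| * (w.length * K₁) ≤ dist z z' * (w.length * K₁) := by gcongr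
  have f₂ : |z.2 - z'.2| * (w.length * K₂) ≤ dist z z' * (w.length * K₂) := by gcongr
  linarith

/-- A function with subgradients `g` near `x₀` that are continuous at `x₀` is differentiable
there. -/
lemma hasDerivAt_of_subgradient {T g : ℝ → ℝ} {x₀ : ℝ} (hg : ContinuousAt g x₀)
    (h : ∀ᶠ x in 𝓝 x₀, (x - x₀) * g x₀ ≤ T x - T x₀ ∧ T x - T x₀ ≤ (x - x₀) * g x) :
    HasDerivAt T (g x₀) x₀ := by
  rw [hasDerivAt_iff_isLittleO, Asymptotics.isLittleO_iff]
  intro ε hε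
  filter_upwards [h, Metric.tendsto_nhds.1 hg ε hε] with x hx hd
  rw [Real.dist_eq] at hd
  simp only [smul_eq_mul, Real.norm_eq_abs]
  have h0 : 0 ≤ T x - T x₀ - (x - x₀) * g x₀ := by linarith [hx.1]
  rw [abs_of_nonneg h0]
  calc T x - T x₀ - (x - x₀) * g x₀ ≤ (x - x₀) * (g x - g x₀) := by linarith [hx.2]
    _ ≤ |x - x₀| * |g x - g x₀| := by rw [← abs_mul]; exact le_abs_self _
    _ ≤ |x - x₀| * ε := by gcongr
    _ = ε * |x - x₀| := mul_comm _ _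

/-- If `P(a + x c + T(x) b) = 0` near `x₀` and `b` decays linearly, then `T` is differentiable at
`x₀`. The variational inequality makes `-Λ(c, ν) / Λ(b, ν)` a subgradient of `T`, and this
quotient depends continuously on `x` because limits of equilibrium states are equilibrium states,
which are unique. -/
theorem hasDerivAt_of_logPressure_eq_zero [Nonempty (Fin N)] (ha : AlmostAdditive A a)
    (hb : AlmostAdditive B b) (hc : AlmostAdditive C c) {k : ℝ} (hk : k < 0)
    (hbk : ∀ w, b w ≤ w.length * k) {T : ℝ → ℝ} {x₀ : ℝ} (hT : ContinuousAt T x₀)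
    (hzero : ∀ᶠ x in 𝓝 x₀, logPressure (fun w => a w + (x * c w + T x * b w)) = 0)
    {ν : Measure (ℕ → Fin N)} (hν : IsInvariant ν)
    (heq : logPressure (fun w => a w + (x₀ * c w + T x₀ * b w)) =
      entropy ν + meanGrowth (fun w => a w + (x₀ * c w + T x₀ * b w)) ν) :
    HasDerivAt T (-(meanGrowth c ν / meanGrowth b ν)) x₀ := by
  have hex : ∀ x, ∃ η : Measure (ℕ → Fin N), IsInvariant η ∧
      logPressure (fun w => a w + (x * c w + T x * b w)) =
        entropy η + meanGrowth (fun w => a w + (x * c w + T x * b w)) η := fun x =>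
    (ha.affine hb hc x (T x)).existsUnique_equilibrium.exists
  choose η hη heqη using hex
  have hηx : η x₀ = ν := (ha.affine hb hc x₀ (T x₀)).existsUnique_equilibrium.unique
    ⟨hη x₀, heqη x₀⟩ ⟨hν, heq⟩
  have hneg : ∀ κ : Measure (ℕ → Fin N), IsInvariant κ → meanGrowth b κ < 0 := by
    intro κ hκ
    have := hb.meanGrowth_le AlmostAdditive.zero hκ (k := k) (B := 0) fun w => by
      simpa using hbk w
    rw [meanGrowth_zero] at this
    linarith
  have h0 : logPressure (fun w => a w + (x₀ * c w + T x₀ * b w)) = 0 := hzero.self_of_nhds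
  -- continuity of the equilibrium states
  have hlim : ∀ U : Ultrafilter ℝ, (U : Filter ℝ) ≤ 𝓝 x₀ →
      ∀ w, Tendsto (fun x => (η x).real (cyl w)) U (𝓝 (ν.real (cyl w))) := by
    intro U hU
    obtain ⟨κ, hκ, hκt⟩ := exists_tendsto_cyl U η fun x => (hη x).1
    have hinv : ∀ᶠ x in (U : Filter ℝ), IsInvariant (η x) := Eventually.of_forall hη
    have hκi := isInvariant_of_tendsto_cyl hinv hκt
    have ta := ha.tendsto_meanGrowth hκi hinv hκt
    have tb := hb.tendsto_meanGrowth hκi hinv hκt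
    have tc := hc.tendsto_meanGrowth hκi hinv hκt
    have tx : Tendsto (fun x : ℝ => x) U (𝓝 x₀) := hU
    have tT : Tendsto T U (𝓝 (T x₀)) := hT.tendsto.mono_left hU
    have hent : Tendsto (fun x => entropy (η x)) U
        (𝓝 (-(meanGrowth a κ + (x₀ * meanGrowth c κ + T x₀ * meanGrowth b κ)))) := by
      refine ((ta.add ((tx.mul tc).add (tT.mul tb))).neg).congr' ?_
      filter_upwards [hU hzero] with x hx
      have h1 := heqη x
      rw [hx, ha.meanGrowth_affine hb hc (hη x)] at h1
      linarith
    have hle := le_entropy_of_tendsto hκi hinv hκt hent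
    have hvar := (ha.affine hb hc x₀ (T x₀)).entropy_add_meanGrowth_le hκi
    have hκν : κ = ν := by
      refine (ha.affine hb hc x₀ (T x₀)).existsUnique_equilibrium.unique
        ⟨hκi, le_antisymm ?_ hvar⟩ ⟨hν, heq⟩
      rw [h0, ha.meanGrowth_affine hb hc hκi]
      linarith
    rwa [hκν] at hκt
  have hg : ContinuousAt (fun x => -(meanGrowth c (η x) / meanGrowth b (η x))) x₀ := by
    refine tendsto_iff_ultrafilter _ _ _ |>.2 fun U hU => ?_
    have hinv : ∀ᶠ x in (U : Filter ℝ), IsInvariant (η x) := Eventually.of_forall hη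
    have tb := hb.tendsto_meanGrowth hν hinv (hlim U hU)
    have tc := hc.tendsto_meanGrowth hν hinv (hlim U hU)
    simp only [hηx]
    exact (tc.div tb (hneg ν hν).ne).neg
  have hsub : ∀ x y, logPressure (fun w => a w + (x * c w + T x * b w)) = 0 →
      logPressure (fun w => a w + (y * c w + T y * b w)) = 0 →
      (y - x) * -(meanGrowth c (η x) / meanGrowth b (η x)) ≤ T y - T x := by
    intro x y hx hy
    have h1 := heqη x
    have h2 := (ha.affine hb hc y (T y)).entropy_add_meanGrowth_le (hη x)
    rw [hx, ha.meanGrowth_affine hb hc (hη x)] at h1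
    rw [hy, ha.meanGrowth_affine hb hc (hη x)] at h2
    have h3 := hneg _ (hη x)
    rw [mul_neg, ← mul_div_assoc, ← neg_div, div_le_iff_of_neg h3]
    linarith
  have hfin := hasDerivAt_of_subgradient hg (T := T) (by
    filter_upwards [hzero] with x hx
    refine ⟨hsub x₀ x h0 hx, ?_⟩
    have := hsub x x₀ hx h0
    linarith)
  simpa only [hηx] using hfin

end Implicit

/-! ### The singular value function and the potentials `ψ^{q,s}` -/

/-- An injective function has at most one zero, so the infimum in the definition of the
dimensions is that zero. -/
lemma sInf_zero_eq {g : ℝ → ℝ} (hg : Function.Injective g) {s : ℝ} (hs : 0 ≤ s)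
    (h : g s = 0) : sInf {s | 0 ≤ s ∧ g s = 0} = s := by
  have : {s | 0 ≤ s ∧ g s = 0} = {s} := by
    ext x
    simp only [Set.mem_ofPred_eq, Set.mem_singleton_iff]
    constructor
    · rintro ⟨-, hx0⟩
      exact hg (hx0.trans h.symm)
    · rintro rfl
      exact ⟨hs, h⟩
  rw [this, csInf_singleton]

/-- A positive value of the infimum is a genuine zero, since the infimum of the empty set is `0`. -/
lemma apply_sInf_zero {g : ℝ → ℝ} (hg : Function.Injective g)
    (h : 0 < sInf {s | 0 ≤ s ∧ g s = 0}) : g (sInf {s | 0 ≤ s ∧ g s = 0}) = 0 := by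
  rcases Set.eq_empty_or_nonempty {s | 0 ≤ s ∧ g s = 0} with he | ⟨s, hs, hs0⟩
  · rw [he, Real.sInf_empty] at h
    exact absurd h (lt_irrefl _)
  · rw [sInf_zero_eq hg hs hs0]
    exact hs0

section Svf

variable (A : Fin N → GL (Fin 2) ℝ)

lemma svf_pos (s : ℝ) (w : List (Fin N)) : 0 < svf A s w := by
  have h1 := alpha1_pos A w
  have h2 := alpha2_pos A w
  have h3 := abs_pos.2 (det_ne_zero (wordProd A w))
  rw [svf]
  split_ifs <;> positivity

lemma log_svf_of_lt_one {s : ℝ} (hs : s < 1) (w : List (Fin N)) :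
    Real.log (svf A s w) = s * Real.log (alpha1 A w) := by
  rw [svf, if_pos hs, Real.log_rpow (alpha1_pos A w)]

lemma log_svf_of_lt_two {s : ℝ} (hs : 1 ≤ s) (hs' : s < 2) (w : List (Fin N)) :
    Real.log (svf A s w) = Real.log (alpha1 A w) + (s - 1) * Real.log (alpha2 A w) := by
  have h2 := alpha2_pos A w
  rw [svf, if_neg (not_lt.2 hs), if_pos hs', Real.log_mul (alpha1_pos A w).ne' (by positivity),
    Real.log_rpow h2]

lemma log_svf_of_two_le {s : ℝ} (hs : 2 ≤ s) (w : List (Fin N)) :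
    Real.log (svf A s w) = s / 2 * (Real.log (alpha1 A w) + Real.log (alpha2 A w)) := by
  rw [svf, if_neg (by linarith), if_neg (not_lt.2 hs),
    Real.log_rpow (abs_pos.2 (det_ne_zero (wordProd A w))), log_alpha2, logDet]
  ring

variable {A}

lemma IsDominated.exists_almostAdditive_svf (hdom : IsDominated A) (s : ℝ) :
    ∃ C, AlmostAdditive C fun w => Real.log (svf A s w) := by
  obtain ⟨C, hC⟩ := hdom.exists_almostAdditive
  obtain ⟨D, hD⟩ := hdom.exists_almostAdditive_alpha2
  rcases lt_or_ge s 1 with h1 | h1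
  · simp only [log_svf_of_lt_one A h1]
    exact ⟨_, hC.const_mul s⟩
  rcases lt_or_ge s 2 with h2 | h2
  · simp only [log_svf_of_lt_two A h1 h2]
    exact ⟨_, hC.add (hD.const_mul (s - 1))⟩
  · simp only [log_svf_of_two_le A h2]
    exact ⟨_, (hC.add hD).const_mul (s / 2)⟩

/-- The slopes of the piecewise affine function `s ↦ log φ^s(w)` are `log α₁`, `log α₂` and
`(log α₁ + log α₂) / 2`, all at most `k |w|`. -/
lemma log_svf_le {k : ℝ} (hk : ∀ w : List (Fin N), Real.log (alpha1 A w) ≤ w.length * k)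
    {s s' : ℝ} (hss : s ≤ s') (w : List (Fin N)) :
    Real.log (svf A s' w) ≤ Real.log (svf A s w) + w.length * ((s' - s) * k) := by
  have h1 := hk w
  have h2 : Real.log (alpha2 A w) ≤ w.length * k :=
    (Real.log_le_log (alpha2_pos A w) (alpha2_le_alpha1 A w)).trans h1
  rw [show (w.length : ℝ) * ((s' - s) * k) = (s' - s) * (w.length * k) by ring]
  set K := (w.length : ℝ) * k
  set x := Real.log (alpha1 A w) with hx
  set y := Real.log (alpha2 A w) with hy
  have hp : ∀ t : ℝ, 0 ≤ t → t * x ≤ t * K ∧ t * y ≤ t * K := fun t ht =>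
    ⟨mul_le_mul_of_nonneg_left h1 ht, mul_le_mul_of_nonneg_left h2 ht⟩
  rcases lt_or_ge s' 1 with a1 | a1
  · rw [log_svf_of_lt_one A a1, log_svf_of_lt_one A (hss.trans_lt a1), ← hx]
    linarith [(hp (s' - s) (by linarith)).1]
  rcases lt_or_ge s' 2 with a2 | a2
  · rw [log_svf_of_lt_two A a1 a2, ← hx, ← hy]
    rcases lt_or_ge s 1 with b1 | b1
    · rw [log_svf_of_lt_one A b1, ← hx]
      linarith [(hp (1 - s) (by linarith)).1, (hp (s' - 1) (by linarith)).2]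
    · rw [log_svf_of_lt_two A b1 (hss.trans_lt a2), ← hx, ← hy]
      linarith [(hp (s' - s) (by linarith)).2]
  · rw [log_svf_of_two_le A a2, ← hx, ← hy]
    have c1 := hp ((s' - 2) / 2) (by linarith)
    rcases lt_or_ge s 1 with b1 | b1
    · rw [log_svf_of_lt_one A b1, ← hx]
      linarith [(hp (1 - s) (by linarith)).1, c1.1, c1.2]
    rcases lt_or_ge s 2 with b2 | b2
    · rw [log_svf_of_lt_two A b1 b2, ← hx, ← hy]
      linarith [(hp (2 - s) (by linarith)).2, c1.1, c1.2]
    · rw [log_svf_of_two_le A b2, ← hx, ← hy]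
      have c2 := hp ((s' - s) / 2) (by linarith)
      linarith [c2.1, c2.2]

/-- On each of the three intervals `log φ^s` is affine in `s`. -/
lemma IsDominated.exists_affine_svf (hdom : IsDominated A) {k : ℝ}
    (hk : ∀ w : List (Fin N), Real.log (alpha1 A w) ≤ w.length * k) {I : Set ℝ}
    (hI : I = Set.Ioo 0 1 ∨ I = Set.Ioo 1 2 ∨ I = Set.Ioi 2) :
    ∃ (a b : List (Fin N) → ℝ) (Ca Cb : ℝ), AlmostAdditive Ca a ∧ AlmostAdditive Cb b ∧
      (∀ w, b w ≤ w.length * k) ∧ ∀ s ∈ I, ∀ w, Real.log (svf A s w) = a w + s * b w := by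
  obtain ⟨C, hC⟩ := hdom.exists_almostAdditive
  obtain ⟨D, hD⟩ := hdom.exists_almostAdditive_alpha2
  have hk2 : ∀ w, Real.log (alpha2 A w) ≤ w.length * k := fun w =>
    (Real.log_le_log (alpha2_pos A w) (alpha2_le_alpha1 A w)).trans (hk w)
  rcases hI with rfl | rfl | rfl
  · refine ⟨fun _ => 0, _, _, _, .zero, hC, hk, fun s hs w => ?_⟩
    rw [log_svf_of_lt_one A hs.2]
    ring
  · refine ⟨_, _, _, _, hC.add (hD.const_mul (-1)), hD, hk2, fun s hs w => ?_⟩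
    rw [log_svf_of_lt_two A hs.1.le hs.2]
    ring
  · refine ⟨fun _ => 0, _, _, _, .zero, (hC.add hD).const_mul (1 / 2), fun w => ?_,
      fun s hs w => ?_⟩
    · linarith [hk w, hk2 w]
    · rw [log_svf_of_two_le A (le_of_lt hs)]
      ring

lemma IsDominated.lyapunov_svf_le (hdom : IsDominated A) {k : ℝ}
    (hk : ∀ w : List (Fin N), Real.log (alpha1 A w) ≤ w.length * k)
    {ν : Measure (ℕ → Fin N)} (hν : IsInvariant ν) {s s' : ℝ} (hss : s ≤ s') :
    lyapunov (svf A s') ν ≤ lyapunov (svf A s) ν + (s' - s) * k := by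
  obtain ⟨C, hC⟩ := hdom.exists_almostAdditive_svf s
  obtain ⟨D, hD⟩ := hdom.exists_almostAdditive_svf s'
  exact hD.meanGrowth_le hC hν (B := 0) fun w => by
    rw [add_zero]
    exact log_svf_le hk hss w

lemma IsDominated.strictAnti_lyapunov_svf (hdom : IsDominated A) {k : ℝ} (hk0 : k < 0)
    (hk : ∀ w : List (Fin N), Real.log (alpha1 A w) ≤ w.length * k)
    {ν : Measure (ℕ → Fin N)} (hν : IsInvariant ν) (h : ℝ) :
    StrictAnti fun s => h + lyapunov (svf A s) ν := by
  intro s s' hss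
  have h1 := hdom.lyapunov_svf_le hk hν hss.le
  have h2 := mul_neg_of_pos_of_neg (sub_pos.2 hss) hk0
  change h + lyapunov (svf A s') ν < h + lyapunov (svf A s) ν
  linarith

end Svf

section Psi

variable (A : Fin N → GL (Fin 2) ℝ) {μ : Measure (ℕ → Fin N)}

lemma measurePotential_pos [IsProbabilityMeasure μ] (hfull : IsFullySupported μ)
    (w : List (Fin N)) : 0 < measurePotential μ w :=
  ENNReal.toReal_pos (hfull w).ne' (measure_ne_top _ _)

lemma IsQuasiBernoulli.exists_almostAdditive [IsProbabilityMeasure μ]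
    (hfull : IsFullySupported μ) (hqb : IsQuasiBernoulli μ) :
    ∃ C, AlmostAdditive C fun w => Real.log (measurePotential μ w) := by
  obtain ⟨C, hC, hsub, hsup⟩ := hqb
  have hC0 : 0 < C := by linarith
  refine ⟨Real.log C, fun u v => ?_⟩
  have pu := measurePotential_pos hfull u
  have pv := measurePotential_pos hfull v
  have puv := measurePotential_pos hfull (u ++ v)
  have h1 := Real.log_le_log (by positivity) (hsub u v)
  have h2 := Real.log_le_log (by positivity) (hsup u v)
  rw [Real.log_mul hC0.ne' puv.ne', Real.log_mul (by positivity) (by positivity),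
    Real.log_mul hC0.ne' pu.ne', Real.log_mul hC0.ne' pv.ne'] at h1
  rw [Real.log_mul (by positivity) puv.ne', Real.log_mul (by positivity) (by positivity),
    Real.log_mul (by positivity) pu.ne', Real.log_mul (by positivity) pv.ne', Real.log_inv] at h2
  rw [abs_le]
  constructor <;> linarith

lemma psi_pos [IsProbabilityMeasure μ] (hfull : IsFullySupported μ) (q s : ℝ)
    (w : List (Fin N)) : 0 < psi A μ q s w :=
  mul_pos (Real.rpow_pos_of_pos (measurePotential_pos hfull w) _)
    (Real.rpow_pos_of_pos (svf_pos A s w) _)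

lemma log_psi [IsProbabilityMeasure μ] (hfull : IsFullySupported μ) (q s : ℝ)
    (w : List (Fin N)) : Real.log (psi A μ q s w) =
      q * Real.log (measurePotential μ w) + (1 - q) * Real.log (svf A s w) := by
  have h1 := measurePotential_pos hfull w
  have h2 := svf_pos A s w
  rw [psi, Real.log_mul (by positivity) (by positivity), Real.log_rpow h1, Real.log_rpow h2]

lemma pressure_psi [IsProbabilityMeasure μ] (hfull : IsFullySupported μ) (q s : ℝ) :
    pressure (psi A μ q s) = logPressure fun w =>
      q * Real.log (measurePotential μ w) + (1 - q) * Real.log (svf A s w) := by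
  rw [logPressure]
  congr 1
  funext w
  rw [← log_psi A hfull, Real.exp_log (psi_pos A hfull q s w)]

variable {A}

/-- Strict monotonicity of `s ↦ P(ψ^{q,s})`, for both signs of `1 - q`. -/
lemma IsDominated.mul_pressure_psi_le [Nonempty (Fin N)] [IsProbabilityMeasure μ]
    (hdom : IsDominated A)
    (hfull : IsFullySupported μ) (hqb : IsQuasiBernoulli μ) {k : ℝ}
    (hk : ∀ w : List (Fin N), Real.log (alpha1 A w) ≤ w.length * k) (q : ℝ)
    {s s' : ℝ} (hss : s ≤ s') :
    (1 - q) * pressure (psi A μ q s') ≤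
      (1 - q) * pressure (psi A μ q s) + (1 - q) ^ 2 * ((s' - s) * k) := by
  obtain ⟨M, hM⟩ := hqb.exists_almostAdditive hfull
  obtain ⟨C, hC⟩ := hdom.exists_almostAdditive_svf s
  obtain ⟨D, hD⟩ := hdom.exists_almostAdditive_svf s'
  have hl := fun w => log_svf_le hk hss w
  rw [pressure_psi A hfull, pressure_psi A hfull]
  have h1 := (hM.const_mul q).add (hC.const_mul (1 - q))
  have h2 := (hM.const_mul q).add (hD.const_mul (1 - q))
  rcases le_total q 1 with hq | hq
  · have := h2.logPressure_le h1 (k := (1 - q) * ((s' - s) * k)) (B := 0) fun w => by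
      have := mul_le_mul_of_nonneg_left (hl w) (sub_nonneg.2 hq)
      linarith
    have := mul_le_mul_of_nonneg_left this (sub_nonneg.2 hq)
    linarith
  · have := h1.logPressure_le h2 (k := (q - 1) * ((s' - s) * k)) (B := 0) fun w => by
      have := mul_le_mul_of_nonneg_left (hl w) (sub_nonneg.2 hq)
      linarith
    have := mul_le_mul_of_nonneg_left this (sub_nonneg.2 hq)
    linarith

lemma IsDominated.strictAnti_mul_pressure_psi [Nonempty (Fin N)] [IsProbabilityMeasure μ]
    (hdom : IsDominated A) (hfull : IsFullySupported μ) (hqb : IsQuasiBernoulli μ) {k : ℝ}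
    (hk0 : k < 0) (hk : ∀ w : List (Fin N), Real.log (alpha1 A w) ≤ w.length * k) {q : ℝ}
    (hq : q ≠ 1) : StrictAnti fun s => (1 - q) * pressure (psi A μ q s) := by
  intro s s' hss
  have h1 := hdom.mul_pressure_psi_le hfull hqb hk q hss.le
  have h2 := mul_neg_of_pos_of_neg (sub_pos.2 hss) hk0
  have h3 : 0 < (1 - q) ^ 2 := pow_two_pos_of_ne_zero (sub_ne_zero.2 hq.symm)
  have h4 := mul_neg_of_pos_of_neg h3 h2
  change (1 - q) * pressure (psi A μ q s') < (1 - q) * pressure (psi A μ q s)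
  linarith

lemma IsDominated.injective_pressure_psi [Nonempty (Fin N)] [IsProbabilityMeasure μ]
    (hdom : IsDominated A) (hfull : IsFullySupported μ) (hqb : IsQuasiBernoulli μ) {k : ℝ}
    (hk0 : k < 0) (hk : ∀ w : List (Fin N), Real.log (alpha1 A w) ≤ w.length * k) {q : ℝ}
    (hq : q ≠ 1) : Function.Injective fun s => pressure (psi A μ q s) := fun _ _ h =>
  (hdom.strictAnti_mul_pressure_psi hfull hqb hk0 hk hq).injective (congrArg ((1 - q) * ·) h)

end Psi

/-! ### The Legendre pair -/

section Main

variable {A : Fin N → GL (Fin 2) ℝ} {μ : Measure (ℕ → Fin N)}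

lemma tau_div {q : ℝ} (hq : q ≠ 1) : tau A μ q / (q - 1) = sq A μ q := by
  rw [tau, mul_div_cancel_left₀ _ (sub_ne_zero.2 hq)]

variable [IsProbabilityMeasure μ]

/-- On an interval where `log φ^s = a + s b`, the potential `log ψ^{q,s}` is affine in `q` and
`(1 - q) s`. -/
lemma log_psi_of_affine (hfull : IsFullySupported μ) {a b : List (Fin N) → ℝ} {I : Set ℝ}
    (haff : ∀ s ∈ I, ∀ w, Real.log (svf A s w) = a w + s * b w) {s : ℝ} (hs : s ∈ I) (q : ℝ) :
    (fun w => Real.log (psi A μ q s w)) = fun w =>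
      a w + (q * (Real.log (measurePotential μ w) + -1 * a w) + ((1 - q) * s) * b w) := by
  funext w
  rw [log_psi A hfull, haff s hs]
  ring

/-- The zero `s_q` of the pressure is continuous in `q`, stays in the interval, and is a genuine
zero nearby. -/
lemma eventually_sq [Nonempty (Fin N)] (hdom : IsDominated A) (hfull : IsFullySupported μ)
    (hqb : IsQuasiBernoulli μ)
    {k : ℝ} (hk0 : k < 0) (hk : ∀ w : List (Fin N), Real.log (alpha1 A w) ≤ w.length * k)
    {I : Set ℝ} (hI : IsOpen I) (hI0 : I ⊆ Set.Ioi 0) {a b : List (Fin N) → ℝ} {Ca Cb : ℝ}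
    (ha : AlmostAdditive Ca a) (hb : AlmostAdditive Cb b)
    (haff : ∀ s ∈ I, ∀ w, Real.log (svf A s w) = a w + s * b w) {q₀ : ℝ} (hq₀ : q₀ ≠ 1)
    (hs : sq A μ q₀ ∈ I) :
    ContinuousAt (sq A μ) q₀ ∧
      ∀ᶠ q in 𝓝 q₀, sq A μ q ∈ I ∧ pressure (psi A μ q (sq A μ q)) = 0 := by
  obtain ⟨Cm, hm⟩ := hqb.exists_almostAdditive hfull
  have hc := hm.add (ha.const_mul (-1))
  set V : ℝ → ℝ → ℝ := fun q s => (1 - q) * pressure (psi A μ q s) with hV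
  have hanti : ∀ {q : ℝ}, q ≠ 1 → StrictAnti (V q) := fun hq =>
    hdom.strictAnti_mul_pressure_psi hfull hqb hk0 hk hq
  have hinj : ∀ {q : ℝ}, q ≠ 1 → Function.Injective fun s => pressure (psi A μ q s) := fun hq =>
    hdom.injective_pressure_psi hfull hqb hk0 hk hq
  have hP₀ : pressure (psi A μ q₀ (sq A μ q₀)) = 0 := apply_sInf_zero (hinj hq₀) (hI0 hs)
  -- on `I` the function `V` is continuous in both variables
  have hcont : Continuous fun z : ℝ × ℝ => (1 - z.1) * logPressure fun w =>
      a w + (z.1 * (Real.log (measurePotential μ w) + -1 * a w) + ((1 - z.1) * z.2) * b w) := by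
    have := (ha.continuous_logPressure hb hc).comp
      (show Continuous fun z : ℝ × ℝ => (z.1, (1 - z.1) * z.2) by fun_prop)
    exact (by fun_prop : Continuous fun z : ℝ × ℝ => 1 - z.1).mul this
  have hVeq : ∀ q, ∀ s ∈ I, V q s = (1 - q) * logPressure fun w =>
      a w + (q * (Real.log (measurePotential μ w) + -1 * a w) + ((1 - q) * s) * b w) := by
    intro q s hs
    rw [← log_psi_of_affine hfull haff hs q]
    simp only [hV, pressure_psi A hfull, log_psi A hfull]
  -- `V` changes sign on a short interval around `s_{q₀}`, for `q₀` and hence for nearby `q`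
  have key : ∀ ε > 0, Set.Icc (sq A μ q₀ - ε) (sq A μ q₀ + ε) ⊆ I →
      ∀ᶠ q in 𝓝 q₀, sq A μ q ∈ Set.Icc (sq A μ q₀ - ε) (sq A μ q₀ + ε) ∧
        pressure (psi A μ q (sq A μ q)) = 0 := by
    intro ε hε hsub
    set s₁ := sq A μ q₀ - ε with hs₁
    set s₂ := sq A μ q₀ + ε with hs₂
    have h12 : s₁ ≤ s₂ := by linarith
    have m₁ : s₁ ∈ I := hsub ⟨le_rfl, h12⟩
    have m₂ : s₂ ∈ I := hsub ⟨h12, le_rfl⟩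
    have hz : V q₀ (sq A μ q₀) = 0 := by simp only [hV, hP₀, mul_zero]
    have v₁ : 0 < V q₀ s₁ := by
      rw [← hz]; exact hanti hq₀ (by linarith)
    have v₂ : V q₀ s₂ < 0 := by
      rw [← hz]; exact hanti hq₀ (by linarith)
    have hcs : ∀ s ∈ I, ContinuousAt (fun q => V q s) q₀ := by
      intro s hs
      simp only [hVeq _ s hs]
      exact (hcont.comp (show Continuous fun q : ℝ => (q, s) by fun_prop)).continuousAt
    filter_upwards [(hcs s₁ m₁).eventually (lt_mem_nhds v₁),
      (hcs s₂ m₂).eventually (gt_mem_nhds v₂), isOpen_ne.mem_nhds hq₀] with q h₁ h₂ hq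
    have hcq : ContinuousOn (V q) (Set.Icc s₁ s₂) := by
      refine ContinuousOn.congr ?_ fun s hs => hVeq q s (hsub hs)
      exact (hcont.comp (show Continuous fun s : ℝ => (q, s) by fun_prop)).continuousOn
    obtain ⟨s, hs, hs0⟩ := intermediate_value_Icc' h12 hcq ⟨h₂.le, h₁.le⟩
    have hp : pressure (psi A μ q s) = 0 :=
      (mul_eq_zero.1 hs0).resolve_left (sub_ne_zero.2 hq.symm)
    have hsq : sq A μ q = s := sInf_zero_eq (hinj hq) (hI0 (hsub hs)).le hp
    rw [hsq]
    exact ⟨hs, hp⟩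
  obtain ⟨δ, hδ, hball⟩ := Metric.isOpen_iff.1 hI _ hs
  have hsub : ∀ ε < δ, Set.Icc (sq A μ q₀ - ε) (sq A μ q₀ + ε) ⊆ I := by
    intro ε hε
    rw [← Real.closedBall_eq_Icc]
    exact (Metric.closedBall_subset_ball hε).trans hball
  constructor
  · refine Metric.tendsto_nhds.2 fun ε hε => ?_
    have hmin : 0 < min (ε / 2) (δ / 2) := by positivity
    have h1 := min_le_left (ε / 2) (δ / 2)
    have h2 := min_le_right (ε / 2) (δ / 2)
    filter_upwards [key _ hmin (hsub _ (by linarith))] with q hq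
    rw [Real.dist_eq, abs_lt]
    constructor <;> linarith [hq.1.1, hq.1.2]
  · filter_upwards [key (δ / 2) (by positivity) (hsub _ (by linarith))] with q hq
    exact ⟨hsub _ (by linarith) hq.1, hq.2⟩

/-- The measure `μ` has zero pressure, so the entropy never exceeds the cross-entropy. -/
lemma entropy_le_crossEntropy [Nonempty (Fin N)] (hfull : IsFullySupported μ)
    (hqb : IsQuasiBernoulli μ)
    {ν : Measure (ℕ → Fin N)} (hν : IsInvariant ν) : entropy ν ≤ crossEntropy μ ν := by
  obtain ⟨Cm, hm⟩ := hqb.exists_almostAdditive hfull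
  have h1 := hm.entropy_add_meanGrowth_le hν
  have h2 : logPressure (fun w => Real.log (measurePotential μ w)) = 0 := by
    refine Tendsto.limUnder_eq ?_
    simp only [Real.exp_log (measurePotential_pos hfull _)]
    simp only [measurePotential, sum_real_cyl, Real.log_one, mul_zero]
    exact tendsto_const_nhds
  rw [h2] at h1
  rw [crossEntropy, lyapunov_eq_meanGrowth]
  linarith

end Main

end SelfAffine

open SelfAffine in
theorem mainTheorem3 {N : ℕ} (A : Fin N → GL (Fin 2) ℝ)
    (hcontr : SelfAffine.IsContractive A) (hdom : SelfAffine.IsDominated A)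
    (μ : Measure (ℕ → Fin N)) (hprob : IsProbabilityMeasure μ)
    (hfull : SelfAffine.IsFullySupported μ) (hqb : SelfAffine.IsQuasiBernoulli μ)
    (q : ℝ) (hq : q ≠ 1) (I : Set ℝ)
    (hI : I = Set.Ioo 0 1 ∨ I = Set.Ioo 1 2 ∨ I = Set.Ioi 2)
    (hs : SelfAffine.tau A μ q / (q - 1) ∈ I) :
    DifferentiableAt ℝ (SelfAffine.tau A μ) q ∧
    (∃! ν : Measure (ℕ → Fin N), SelfAffine.IsEquilibriumState
      (SelfAffine.psi A μ q (SelfAffine.tau A μ q / (q - 1))) ν) ∧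
    (deriv (SelfAffine.tau A μ) q ∈ I →
      q * deriv (SelfAffine.tau A μ) q - SelfAffine.tau A μ q ∈ I →
      (1 < q → deriv (SelfAffine.tau A μ) q ≤ SelfAffine.tau A μ q / (q - 1)) ∧
      (q < 1 → SelfAffine.tau A μ q / (q - 1) ≤ deriv (SelfAffine.tau A μ) q) ∧
      ∀ ν : Measure (ℕ → Fin N), SelfAffine.IsEquilibriumState
          (SelfAffine.psi A μ q (SelfAffine.tau A μ q / (q - 1))) ν →
        SelfAffine.symbolicSpectrum A μ (deriv (SelfAffine.tau A μ) q) = SelfAffine.dimL A ν ∧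
        SelfAffine.dimL A ν = q * deriv (SelfAffine.tau A μ) q - SelfAffine.tau A μ q) := by
  have hne : Nonempty (Fin N) := by
    obtain ⟨x⟩ := nonempty_of_isProbabilityMeasure μ
    exact ⟨x 0⟩
  have hIopen : IsOpen I := by
    rcases hI with rfl | rfl | rfl
    exacts [isOpen_Ioo, isOpen_Ioo, isOpen_Ioi]
  have hI0 : I ⊆ Set.Ioi 0 := by
    rcases hI with rfl | rfl | rfl <;> intro x hx
    · exact hx.1
    · exact zero_lt_one.trans hx.1
    · exact (two_pos (α := ℝ)).trans hx
  obtain ⟨k, hk0, hk⟩ := hcontr.exists_alpha1_le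
  obtain ⟨a, b, Ca, Cb, ha, hb, hbk, haff⟩ := hdom.exists_affine_svf hk hI
  obtain ⟨Cm, hm⟩ := hqb.exists_almostAdditive hfull
  have hc := hm.add (ha.const_mul (-1))
  rw [tau_div hq] at hs ⊢
  obtain ⟨hcont, hev⟩ := eventually_sq hdom hfull hqb hk0 hk hIopen hI0 ha hb haff hq hs
  -- in the coordinates `(x, T)` with `T = (1 - x) s` the potentials `log ψ` form a linear family
  set T : ℝ → ℝ := fun x => (1 - x) * sq A μ x with hT
  set c : List (Fin N) → ℝ := fun w => Real.log (measurePotential μ w) + -1 * a w with hcdef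
  have hlogψ := log_psi_of_affine (μ := μ) hfull haff hs q
  have hpres : ∀ {x : ℝ}, sq A μ x ∈ I → pressure (psi A μ x (sq A μ x)) =
      logPressure fun w => a w + (x * c w + T x * b w) := by
    intro x hx
    have h := log_psi_of_affine (μ := μ) hfull haff hx x
    rw [pressure_psi A hfull]
    simp only [log_psi A hfull] at h
    rw [h]
  have hstate : ∀ ν, IsEquilibriumState (psi A μ q (sq A μ q)) ν ↔ IsInvariant ν ∧
      logPressure (fun w => a w + (q * c w + T q * b w)) =
        entropy ν + meanGrowth (fun w => a w + (q * c w + T q * b w)) ν := by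
    intro ν
    rw [IsEquilibriumState, hpres hs, lyapunov_eq_meanGrowth, hlogψ]
  have huniq := (ha.affine hb hc q (T q)).existsUnique_equilibrium
  have hex : ∃! ν, IsEquilibriumState (psi A μ q (sq A μ q)) ν := by
    simpa only [hstate] using huniq
  obtain ⟨ν, hν, hνuniq⟩ := hex
  obtain ⟨hνi, hνeq⟩ := (hstate ν).1 hν
  have hzero : ∀ᶠ x in 𝓝 q, logPressure (fun w => a w + (x * c w + T x * b w)) = 0 := by
    filter_upwards [hev] with x hx
    rw [← hpres hx.1, hx.2]
  have hTc : ContinuousAt T q := (by fun_prop : ContinuousAt (fun x : ℝ => 1 - x) q).mul hcont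
  have hderivT := hasDerivAt_of_logPressure_eq_zero ha hb hc hk0 hbk hTc hzero hνi hνeq
  have htau : tau A μ = fun x => -T x := by
    funext x
    simp only [tau, hT]
    ring
  have hderiv : HasDerivAt (tau A μ) (meanGrowth c ν / meanGrowth b ν) q := by
    rw [htau]
    have h := hderivT.neg
    rw [neg_neg] at h
    exact h
  refine ⟨hderiv.differentiableAt, ⟨ν, hν, hνuniq⟩, fun hd he => ?_⟩
  set d := deriv (tau A μ) q with hddef
  set e := q * d - tau A μ q with hedef
  -- the affine structure of the Lyapunov exponents of an invariant measure
  have hgrow : ∀ η : Measure (ℕ → Fin N), IsInvariant η → ∀ s ∈ I,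
      lyapunov (svf A s) η = meanGrowth a η + s * meanGrowth b η := by
    intro η hη s hs
    rw [lyapunov_eq_meanGrowth, funext (haff s hs)]
    simpa using ha.meanGrowth_const_mul_add hb hη 1 s
  have hcgrow : ∀ η : Measure (ℕ → Fin N), IsInvariant η →
      meanGrowth c η = -crossEntropy μ η - meanGrowth a η := by
    intro η hη
    have := hm.meanGrowth_const_mul_add ha hη 1 (-1)
    simp only [one_mul] at this
    rw [crossEntropy, lyapunov_eq_meanGrowth, hcdef, this]
    ring
  have hanti : ∀ η : Measure (ℕ → Fin N), IsInvariant η → ∀ h : ℝ,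
      StrictAnti fun s => h + lyapunov (svf A s) η := fun η hη h =>
    hdom.strictAnti_lyapunov_svf hk0 hk hη h
  have hbneg : meanGrowth b ν < 0 := by
    have := hb.meanGrowth_le AlmostAdditive.zero hνi (k := k) (B := 0) fun w => by
      simpa using hbk w
    rw [meanGrowth_zero] at this
    linarith
  have hTq : T q = -tau A μ q := by rw [htau]; ring
  have h0 : logPressure (fun w => a w + (q * c w + T q * b w)) = 0 := hzero.self_of_nhds
  have hdb : d * meanGrowth b ν = meanGrowth c ν := by
    rw [hddef, hderiv.deriv, div_mul_cancel₀ _ hbneg.ne]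
  -- the derivative formula says `Λ(μ, ν) = Λ(φ^d, ν)`, and then `P(ψ) = 0` says
  -- `h(ν) + Λ(φ^e, ν) = 0`
  have hcross : crossEntropy μ ν + lyapunov (svf A d) ν = 0 := by
    rw [hgrow ν hνi d hd, hdb, hcgrow ν hνi]
    ring
  have hent : entropy ν + lyapunov (svf A e) ν = 0 := by
    rw [h0, ha.meanGrowth_affine hb hc hνi, hTq, ← hdb] at hνeq
    rw [hgrow ν hνi e he, hedef]
    linarith
  have hcrossdim : crossDimL A μ ν = d :=
    sInf_zero_eq (hanti ν hνi _).injective (hI0 hd).le hcross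
  have hdim : dimL A ν = e := sInf_zero_eq (hanti ν hνi _).injective (hI0 he).le hent
  -- `h(ν) ≤ h(μ, ν)` compares the zeros `e` and `d`
  have hed : e ≤ d := by
    by_contra! hlt
    have h1 := hanti ν hνi (entropy ν) hlt
    have h2 := entropy_le_crossEntropy hfull hqb hνi
    simp only at h1
    linarith
  have hsq : tau A μ q = (q - 1) * sq A μ q := rfl
  refine ⟨fun h1 => ?_, fun h1 => ?_, fun η hη => ?_⟩
  · refine le_of_mul_le_mul_left ?_ (sub_pos.2 h1)
    linarith
  · refine le_of_mul_le_mul_left ?_ (sub_pos.2 h1)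
    linarith
  · rw [hνuniq η hη]
    refine ⟨?_, hdim⟩
    refine IsGreatest.csSup_eq ⟨⟨ν, hνi, hcrossdim, rfl⟩, ?_⟩
    rintro _ ⟨κ, hκ, hκd, rfl⟩
    rw [hdim]
    -- the variational inequality for `κ` reads `h(κ) + Λ(φ^e, κ) ≤ 0`
    have hκcross : crossEntropy μ κ + lyapunov (svf A d) κ = 0 := by
      have := apply_sInf_zero (hanti κ hκ (crossEntropy μ κ)).injective
        (show 0 < crossDimL A μ κ by rw [hκd]; exact hI0 hd)
      change crossEntropy μ κ + lyapunov (svf A (crossDimL A μ κ)) κ = 0 at this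
      rwa [hκd] at this
    have hvar := (ha.affine hb hc q (T q)).entropy_add_meanGrowth_le hκ
    rw [h0, ha.meanGrowth_affine hb hc hκ, hTq, hcgrow κ hκ] at hvar
    rw [hgrow κ hκ d hd] at hκcross
    have hle : entropy κ + lyapunov (svf A e) κ ≤ 0 := by
      rw [hgrow κ hκ e he, hedef]
      have : crossEntropy μ κ = -(meanGrowth a κ + d * meanGrowth b κ) := by linarith
      rw [this] at hvar
      linarith
    -- were `dim_L κ > e > 0`, it would be a genuine zero, against monotonicity
    by_contra! hlt
    have hpos : 0 < dimL A κ := (hI0 he).out.trans hlt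
    have hroot : entropy κ + lyapunov (svf A (dimL A κ)) κ = 0 :=
      apply_sInf_zero (hanti κ hκ (entropy κ)).injective hpos
    have := hanti κ hκ (entropy κ) hlt
    simp only at this
    linarith
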